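/- Let $G$ be a finite simple graph. For $n,d\in\mathbb N$ and $\lambda\in\mathbb R$, call $G$ an $(n,d,\lambda)$-graph if $G$ has $n$ vertices, is $d$-regular, and the eigenvalues $\lambda_1\ge\lambda_2\ge\dots\ge\lambda_n$ of its adjacency matrix, listed with multiplicity, satisfy $|\lambda_i|\le\lambda$ for all $2\le i\le n$. A leaf of a tree is a vertex of degree one. **Theorem.** For every $\Delta\in\mathbb N$ and every real $\alpha>0$ there is a constant $C>0$ (depending only on $\Delta$ and $\alpha$) such that for all sufficiently large $d\in\mathbb N$ (that is, for all $d\ge d_0$, where $d_0$ depends only on $\Delta$, $\alpha$ and $C$) the following holds. For every $n\in\mathbb N$ and every real $\lambda>0$, if $G$ is an $(n,d,\lambda)$-graph with $d/\lambda\ge C$, then $G$ contains a copy of every $n$-vertex tree with maximum degree at most $\Delta$ and at least $\alpha n$ leaves, that is, a subgraph of $G$ (not necessarily induced) isomorphic to the tree. -/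

import Mathlib

/-- `G` is an `(n, d, lam)`-graph: it has `n` vertices, it is `d`-regular, and when the eigenvalues
of its adjacency matrix are listed with multiplicity in non-increasing order, all but the first
(the trivial eigenvalue `d`) are at most `lam` in absolute value.
Mathlib's `eigenvalues₀` is this non-increasing list, indexed from `0`. -/
structure SimpleGraph.IsNDLambda {V : Type*} [Fintype V] [DecidableEq V]
    (G : SimpleGraph V) [DecidableRel G.Adj] (n d : ℕ) (lam : ℝ) : Prop where
  card_eq : Fintype.card V = n
  regular : G.IsRegularOfDegree d
  abs_eigenvalue_le : ∀ i : Fin (Fintype.card V), (i : ℕ) ≠ 0 →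
    |(G.isHermitian_adjMatrix ℝ).eigenvalues₀ i| ≤ lam

/-- The set of leaves (vertices of degree one) of a finite graph. -/
def SimpleGraph.leafFinset {W : Type*} [Fintype W] (T : SimpleGraph W) [DecidableRel T.Adj] :
    Finset W :=
  Finset.univ.filter fun w => T.degree w = 1

/-! Choose one leaf below each parent of leaves and delete these leaves from the tree; with bounded
degree, linearly many vertices go. The remaining tree is far from spanning. It is embedded first,
and the deleted leaves are then placed by Hall's theorem between the images of their parents and the
unused vertices, two sets of equal size.

Hall's condition rests on two disjoint reservoirs `U` and `R` into which all small sets expand. The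
embedding avoids `U`, so a small set of parents has enough unused neighbours. It covers all of `R`
by parents, so a small set of unused vertices has many neighbours among the parents; this handles
large sets of parents, which by the mixing lemma miss fewer than `m` unused vertices. The reservoirs
are colour classes of a random colouring. As `d` need not grow with `n`, a union bound over the
vertices is not available, and the local lemma gives every vertex its share of neighbours in each
class.

Covering `R` exactly is the main difficulty (`RootedTree.exists_embedding`). The embedding grows by
the Friedman–Pippenger method, in a form with charges that survives deleting vertices (`Ext.mono`).
Hence one can grow `K`-ary forests of depth `a` from embedded vertices and from uncovered vertices
of `R`, join two of their leaves by an edge, and keep only the resulting path of length `2 * a + 1`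
(`Ext.exists_link`). Fewer than about `m / K ^ a` vertices of `R` stay uncovered when enough tree
paths of this length are tried (`Valid.exists_cover`). Phases `a = 0, 1, 2, ...` therefore leave
geometrically fewer uncovered vertices. Each phase uses a fresh part of the tree and hands a
constant proportion of the parents to the next (`exists_descendant`); `K` is chosen so that the
uncovered set shrinks at least as fast as this supply, up to a fixed factor. -/

open Finset

set_option linter.unusedSectionVars false

/-! ### Friedman–Pippenger extension with charges. -/

namespace TreeEmbedding

variable {V : Type*} [Fintype V] [DecidableEq V]

/-- The union of the neighbourhoods of the vertices of `X`. -/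
def nbhd (G : SimpleGraph V) [DecidableRel G.Adj] (X : Finset V) : Finset V :=
  X.biUnion fun v => G.neighborFinset v

/-- Any two sets of at least `m` vertices are joined by an edge. -/
def Joined (G : SimpleGraph V) (m : ℕ) : Prop :=
  ∀ X Y : Finset V, m ≤ #X → m ≤ #Y → ∃ x ∈ X, ∃ y ∈ Y, G.Adj x y

/-- The Friedman–Pippenger condition: `O ∪ A` is the set of occupied vertices, and every `u ∈ A` is
charged to its neighbour `g u`, whose demand `D` for free neighbours it lowers by one. -/
def Ext (G : SimpleGraph V) [DecidableRel G.Adj] (O : Finset V) (D M : ℕ) (A : Finset V)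
    (g : V → V) : Prop :=
  ∀ X : Finset V, #X ≤ M → D * #X ≤ #(nbhd G X \ (O ∪ A)) + #{u ∈ A | g u ∈ X}

variable {G : SimpleGraph V} [DecidableRel G.Adj] {O A A' : Finset V} {D M m K : ℕ} {g g' : V → V}

lemma mem_nbhd {X : Finset V} {u : V} : u ∈ nbhd G X ↔ ∃ x ∈ X, G.Adj x u := by
  simp [nbhd]

lemma nbhd_union (X Y : Finset V) : nbhd G (X ∪ Y) = nbhd G X ∪ nbhd G Y := by
  ext u; simp only [mem_nbhd, mem_union]; grind

lemma Ext.congr (h : Ext G O D M A g) (hg : ∀ u ∈ A, g' u = g u) : Ext G O D M A g' := by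
  intro X hX
  have : {u ∈ A | g' u ∈ X} = {u ∈ A | g u ∈ X} :=
    filter_congr fun u hu => by rw [hg u hu]
  rw [this]; exact h X hX

/-- A released vertex charged to `X` is adjacent to its charge, so it becomes a free neighbour of
`X`: what the charge count loses, the free neighbourhood regains. This roll-back allows auxiliary
forests to be grown and then discarded except for one path. -/
lemma Ext.mono (h : Ext G O D M A' g) (hA : A ⊆ A') (hadj : ∀ u ∈ A', G.Adj (g u) u)
    (hO : Disjoint A' O) : Ext G O D M A g := by
  intro X hX
  have h1 := h X hX
  have e1 : {u ∈ A' | g u ∈ X} = {u ∈ A | g u ∈ X} ∪ {u ∈ A' \ A | g u ∈ X} := by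
    ext u; simp only [mem_filter, mem_union, mem_sdiff]; grind
  have e2 : (nbhd G X \ (O ∪ A')) ∪ {u ∈ A' \ A | g u ∈ X} ⊆ nbhd G X \ (O ∪ A) := by
    intro u hu
    simp only [mem_union, mem_sdiff, mem_filter] at hu ⊢
    rcases hu with hu | hu
    · exact ⟨hu.1, fun h => hu.2 (h.imp id fun h => hA h)⟩
    · refine ⟨mem_nbhd.2 ⟨g u, hu.2, hadj u hu.1.1⟩, ?_⟩
      rintro (h | h)
      · exact disjoint_left.1 hO hu.1.1 h
      · exact hu.1.2 h
  have e3 : Disjoint (nbhd G X \ (O ∪ A')) {u ∈ A' \ A | g u ∈ X} := by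
    rw [disjoint_left]; intro u hu hu'
    simp only [mem_union, mem_sdiff, mem_filter] at hu hu'
    exact hu.2 (Or.inr hu'.1.1)
  have e4 := card_le_card e2
  rw [card_union_of_disjoint e3] at e4
  have e5 := card_union_le {u ∈ A | g u ∈ X} {u ∈ A' \ A | g u ∈ X}
  rw [← e1] at e5
  omega

lemma Joined.card_le (hJ : Joined G m) {X : Finset V} (hX : m ≤ #X) :
    Fintype.card V < #(nbhd G X) + m ∨ m = 0 := by
  by_contra! hc
  have h1 : m ≤ #(nbhd G X)ᶜ := by
    rw [card_compl]; omega
  obtain ⟨x, hx, y, hy, hxy⟩ := hJ X _ hX h1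
  exact (mem_compl.1 hy) (mem_nbhd.2 ⟨x, hx, hxy⟩)

/-- Neighbourhood size is submodular and the charge count is modular. Consequently the sets at which
`Ext` is tight are closed under union, as long as sizes stay in range. -/
lemma supply_submodular (X Y : Finset V) :
    (#(nbhd G (X ∪ Y) \ O) + #{u ∈ A | g u ∈ X ∪ Y}) +
      (#(nbhd G (X ∩ Y) \ O) + #{u ∈ A | g u ∈ X ∩ Y}) ≤
    (#(nbhd G X \ O) + #{u ∈ A | g u ∈ X}) + (#(nbhd G Y \ O) + #{u ∈ A | g u ∈ Y}) := by
  have a0 : nbhd G (X ∪ Y) \ O = (nbhd G X \ O) ∪ (nbhd G Y \ O) := by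
    rw [nbhd_union, union_sdiff_distrib]
  have a1 : nbhd G (X ∩ Y) \ O ⊆ (nbhd G X \ O) ∩ (nbhd G Y \ O) := by
    intro u; simp only [mem_sdiff, mem_inter, mem_nbhd]; grind
  have a2 : {u ∈ A | g u ∈ X ∪ Y} = {u ∈ A | g u ∈ X} ∪ {u ∈ A | g u ∈ Y} := by
    ext u; simp only [mem_filter, mem_union]; grind
  have a3 : {u ∈ A | g u ∈ X ∩ Y} = {u ∈ A | g u ∈ X} ∩ {u ∈ A | g u ∈ Y} := by
    ext u; simp only [mem_filter, mem_inter]; grind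
  have b1 := card_union_add_card_inter (nbhd G X \ O) (nbhd G Y \ O)
  have b2 := card_union_add_card_inter {u ∈ A | g u ∈ X} {u ∈ A | g u ∈ Y}
  have b3 := card_le_card a1
  rw [a0, a2, a3]
  omega

/-- Joinedness alone gives a strict surplus between sizes `m` and `2 * m`. A tight set of size at
most `2 * m` therefore has fewer than `m` elements, and a union of two such sets never leaves the
range controlled by `Ext`. -/
lemma Joined.supply_large (hJ : Joined G m) (hm : 0 < m)
    (hcap : #O + m + 2 * m * D < Fintype.card V) {X : Finset V} (h1 : m ≤ #X)
    (h2 : #X ≤ 2 * m) : D * #X < #(nbhd G X \ O) := by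
  rcases hJ.card_le h1 with h3 | h3
  · have h4 := le_card_sdiff O (nbhd G X)
    have h5 : D * #X ≤ 2 * m * D := by rw [mul_comm]; gcongr
    omega
  · omega

/-- Occupying `u` costs `X` one unit exactly when `u` is a neighbour of `X`, and the new charge
repays it when `y ∈ X`. So a violated set was already tight, sees `u` and omits `y`. -/
lemma Ext.critical_of_not_insert (h : Ext G O D M A g) {y u : V} (hu : u ∉ O ∪ A)
    (hE : ¬ Ext G O D M (insert u A) (Function.update g u y)) :
    ∃ X : Finset V, #X ≤ M ∧ #(nbhd G X \ (O ∪ A)) + #{u ∈ A | g u ∈ X} ≤ D * #X ∧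
      u ∈ nbhd G X ∧ y ∉ X := by
  simp only [Ext] at hE
  push Not at hE
  obtain ⟨X, hX, hX2⟩ := hE
  have h2 := h X hX
  have huA : u ∉ A := fun h => hu (mem_union_right _ h)
  have e2 : {w ∈ A | Function.update g u y w ∈ X} = {w ∈ A | g w ∈ X} := by
    apply filter_congr; intro w hw
    rw [Function.update_of_ne]; rintro rfl; exact huA hw
  have e3 : nbhd G X \ (O ∪ insert u A) = (nbhd G X \ (O ∪ A)).erase u := by
    ext w; simp only [mem_sdiff, mem_union, mem_insert, mem_erase]; tauto
  rw [e3, filter_insert, e2, Function.update_self, card_erase_eq_ite] at hX2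
  have hins : #{w ∈ A | g w ∈ X} < #(insert u {w ∈ A | g w ∈ X}) := by
    rw [card_insert_of_notMem (by simp [huA])]; omega
  by_cases hmem : u ∈ nbhd G X \ (O ∪ A)
  · have hpos := card_pos.2 ⟨u, hmem⟩
    rw [if_pos hmem] at hX2
    by_cases hyX : y ∈ X
    · rw [if_pos hyX] at hX2; omega
    · rw [if_neg hyX] at hX2
      exact ⟨X, hX, by omega, (mem_sdiff.1 hmem).1, hyX⟩
  · rw [if_neg hmem] at hX2
    split_ifs at hX2 <;> omega

/-- The Friedman–Pippenger extension step. -/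
lemma Ext.extend (h : Ext G O D (2 * m) A g) (hJ : Joined G m) (hm : 0 < m)
    (hcap : #(O ∪ A) + m + 2 * m * D < Fintype.card V) {y : V}
    (hy : #{u ∈ A | g u = y} < D) :
    ∃ u, u ∉ O ∪ A ∧ G.Adj y u ∧ Ext G O D (2 * m) (insert u A) (Function.update g u y) := by
  by_contra! hc
  have hlarge : ∀ X : Finset V, #X ≤ 2 * m →
      #(nbhd G X \ (O ∪ A)) + #{u ∈ A | g u ∈ X} ≤ D * #X → #X < m := by
    intro X h1 h2
    by_contra! h3
    have := hJ.supply_large hm hcap h3 h1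
    omega
  -- If every free neighbour of `y` fails, the union of their critical sets is one critical set that
  -- sees them all and still omits `y`.
  have hunion : ∀ F : Finset V, (∀ u ∈ F, u ∉ O ∪ A ∧ G.Adj y u) →
      ∃ X : Finset V, #X < m ∧ #(nbhd G X \ (O ∪ A)) + #{u ∈ A | g u ∈ X} ≤ D * #X ∧
        F ⊆ nbhd G X ∧ y ∉ X := by
    intro F
    induction F using Finset.induction_on with
    | empty =>
      intro _
      exact ⟨∅, by simpa, by simp [nbhd], by simp, by simp⟩
    | insert u F hu ih =>
      intro hF
      obtain ⟨X, h1, h2, h3, h4⟩ := ih fun w hw => hF w (mem_insert_of_mem hw)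
      obtain ⟨hu1, hu2⟩ := hF u (mem_insert_self _ _)
      obtain ⟨Y, g1, g2, g3, g4⟩ := h.critical_of_not_insert hu1 (hc u hu1 hu2)
      have g1 := hlarge Y g1 g2
      have hc1 := card_union_add_card_inter X Y
      have hXY := supply_submodular (G := G) (O := O ∪ A) (A := A) (g := g) X Y
      have hi := h (X ∩ Y) (by omega)
      have he : D * #(X ∪ Y) + D * #(X ∩ Y) = D * #X + D * #Y := by
        rw [← mul_add, ← mul_add, hc1]
      have hle : #(nbhd G (X ∪ Y) \ (O ∪ A)) + #{u ∈ A | g u ∈ X ∪ Y} ≤ D * #(X ∪ Y) := by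
        omega
      refine ⟨X ∪ Y, hlarge _ (by omega) hle, hle, ?_, by simp [h4, g4]⟩
      rw [nbhd_union]
      intro w hw
      rcases mem_insert.1 hw with rfl | hw
      · exact mem_union_right _ g3
      · exact mem_union_left _ (h3 hw)
  obtain ⟨X, h1, h2, h3, h4⟩ := hunion {u | u ∉ O ∪ A ∧ G.Adj y u} (by simp)
  -- Adding `y` to `X` raises the demand by `D`, brings no new free neighbour, and by `hy` brings
  -- fewer than `D` charges: a contradiction.
  have h5 := h (insert y X) (by rw [card_insert_of_notMem h4]; omega)
  have h6 : nbhd G (insert y X) \ (O ∪ A) ⊆ nbhd G X \ (O ∪ A) := by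
    intro w hw
    obtain ⟨hw, hw2⟩ := mem_sdiff.1 hw
    refine mem_sdiff.2 ⟨?_, hw2⟩
    obtain ⟨x, hx, hxw⟩ := mem_nbhd.1 hw
    rcases mem_insert.1 hx with rfl | hx
    · exact h3 (by simp only [mem_filter, mem_univ, true_and]; exact ⟨hw2, hxw⟩)
    · exact mem_nbhd.2 ⟨x, hx, hxw⟩
  have h7 : {u ∈ A | g u ∈ insert y X} = {u ∈ A | g u = y} ∪ {u ∈ A | g u ∈ X} := by
    ext u; simp only [mem_filter, mem_union, mem_insert]; tauto
  have h8 := card_union_le {u ∈ A | g u = y} {u ∈ A | g u ∈ X}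
  have h9 := card_le_card h6
  rw [h7, card_insert_of_notMem h4, mul_add] at h5
  omega

/-! ### Forests and links. -/

/-- Attach `K` new leaves to every vertex of `Z`. -/
lemma Ext.grow_layer (h : Ext G O D (2 * m) A g) (hJ : Joined G m) (hm : 0 < m) {Z : Finset V}
    (hZ : ∀ z ∈ Z, #{u ∈ A | g u = z} + K ≤ D)
    (hcap : #(O ∪ A) + K * #Z + m + 2 * m * D < Fintype.card V) :
    ∃ A' g', A ⊆ A' ∧ (∀ u ∈ A, g' u = g u) ∧ Ext G O D (2 * m) A' g' ∧ #(A' \ A) = K * #Z ∧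
      ∀ u ∈ A' \ A, u ∉ O ∧ g' u ∈ Z ∧ G.Adj (g' u) u := by
  have key : ∀ j, j ≤ K * #Z → ∃ A' g', A ⊆ A' ∧ (∀ u ∈ A, g' u = g u) ∧
      Ext G O D (2 * m) A' g' ∧ #(A' \ A) = j ∧
      (∀ u ∈ A' \ A, u ∉ O ∧ g' u ∈ Z ∧ G.Adj (g' u) u) ∧
      ∀ z ∈ Z, #{u ∈ A' \ A | g' u = z} ≤ K := by
    intro j
    induction j with
    | zero => exact fun _ => ⟨A, g, Subset.rfl, by simp, h, by simp, by simp, by simp⟩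
    | succ j ih =>
      intro hj
      obtain ⟨A', g', h1, h2, h3, h4, h5, h6⟩ := ih (by omega)
      have hz : ∃ z ∈ Z, #{u ∈ A' \ A | g' u = z} < K := by
        by_contra! hcon
        have e1 : #(A' \ A) = ∑ z ∈ Z, #{u ∈ A' \ A | g' u = z} :=
          card_eq_sum_card_fiberwise fun u hu => (h5 u hu).2.1
        have e2 : K * #Z ≤ ∑ z ∈ Z, #{u ∈ A' \ A | g' u = z} := by
          rw [mul_comm, ← smul_eq_mul]
          exact card_nsmul_le_sum _ _ _ hcon
        omega
      obtain ⟨z, hzZ, hzK⟩ := hz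
      have e3 : {u ∈ A' | g' u = z} ⊆ {u ∈ A | g u = z} ∪ {u ∈ A' \ A | g' u = z} := by
        intro u hu
        simp only [mem_filter, mem_union, mem_sdiff] at hu ⊢
        by_cases huA : u ∈ A
        · rw [h2 u huA] at hu; exact Or.inl ⟨huA, hu.2⟩
        · exact Or.inr ⟨⟨hu.1, huA⟩, hu.2⟩
      have e4 := (card_le_card e3).trans (card_union_le _ _)
      have e5 : #(O ∪ A') ≤ #(O ∪ A) + j := by
        rw [← h4]
        refine (card_le_card ?_).trans (card_union_le _ _)
        intro u; simp only [mem_union, mem_sdiff]; grind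
      obtain ⟨u, hu, hzu, hE⟩ := h3.extend hJ hm (by omega) (y := z) (by have := hZ z hzZ; omega)
      have huA' : u ∉ A' := fun h => hu (mem_union_right _ h)
      have huO : u ∉ O := fun h => hu (mem_union_left _ h)
      have huA : u ∉ A := fun h => huA' (h1 h)
      have e6 : insert u A' \ A = insert u (A' \ A) := insert_sdiff_of_notMem _ huA
      have hne : ∀ w ∈ A', Function.update g' u z w = g' w := by
        intro w hw; rw [Function.update_of_ne]; rintro rfl; exact huA' hw
      refine ⟨insert u A', Function.update g' u z, h1.trans (subset_insert _ _),
        fun w hw => by rw [hne w (h1 hw), h2 w hw], hE, ?_, ?_, ?_⟩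
      · rw [e6, card_insert_of_notMem (by simp [huA']), h4]
      · intro w hw
        rw [e6] at hw
        rcases mem_insert.1 hw with rfl | hw
        · simp [huO, hzZ, hzu]
        · rw [hne w (mem_sdiff.1 hw).1]; exact h5 w hw
      · intro x hx
        have e7 : {w ∈ A' \ A | Function.update g' u z w = x} = {w ∈ A' \ A | g' w = x} :=
          filter_congr fun w hw => by rw [hne w (mem_sdiff.1 hw).1]
        rw [e6, filter_insert, e7]
        split_ifs with hzx
        · simp at hzx
          subst hzx
          exact (card_insert_le _ _).trans hzK
        · exact h6 x hx
  obtain ⟨A', g', h1, h2, h3, h4, h5, _⟩ := key _ le_rfl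
  exact ⟨A', g', h1, h2, h3, h4, h5⟩

/-- Grow a `K`-ary forest of depth `a` from the vertices of `Z`. -/
lemma Ext.grow_forest (hJ : Joined G m) (hm : 0 < m) (hK : 2 ≤ K) (hKD : K ≤ D) (a : ℕ) :
    ∀ {A : Finset V} {g : V → V} {Z : Finset V}, Ext G O D (2 * m) A g → Z ⊆ O ∪ A →
    (∀ z ∈ Z, #{u ∈ A | g u = z} + K ≤ D) → (∀ u ∈ A, u ∉ O ∧ g u ∈ O ∪ A) →
    #(O ∪ A) + 2 * (#Z * K ^ a) + m + 2 * m * D < Fintype.card V + 2 * #Z →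
    ∃ A' g' Y, A ⊆ A' ∧ (∀ u ∈ A, g' u = g u) ∧ Ext G O D (2 * m) A' g' ∧
      #(A' \ A) + 2 * #Z ≤ 2 * (#Z * K ^ a) ∧
      (∀ u ∈ A' \ A, u ∉ O ∧ (g' u ∈ Z ∨ g' u ∈ A' \ A) ∧ G.Adj (g' u) u) ∧
      #Y = #Z * K ^ a ∧
      ∀ y ∈ Y, ∃ p : ℕ → V, p 0 ∈ Z ∧ p a = y ∧
        (∀ i < a, p (i + 1) ∈ A' \ A ∧ g' (p (i + 1)) = p i) ∧ Set.InjOn p (Set.Iic a) := by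
  induction a with
  | zero =>
    intro A g Z h _ _ _ _
    refine ⟨A, g, Z, Subset.rfl, by simp, h, by simp, by simp, by simp, fun y hy =>
      ⟨fun _ => y, hy, rfl, by simp, ?_⟩⟩
    intro i hi j hj _
    simp at hi hj; omega
  | succ a ih =>
    intro A g Z h hZO hZ hA hcap
    have hp : 2 * (K * #Z) ≤ 2 * (#Z * K ^ (a + 1)) := by
      rw [pow_succ, mul_comm K]; gcongr
      exact Nat.le_mul_of_pos_left _ (by positivity)
    -- The geometric sum `K + ... + K ^ a` is at most `2 * K ^ a - 2` because `K ≥ 2`. This bound,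
    -- stated without subtraction, reproduces itself in the induction.
    have hp2 : 2 * #Z ≤ K * #Z := by gcongr
    obtain ⟨A₁, g₁, h1, h2, h3, h4, h5⟩ := h.grow_layer hJ hm hZ (by omega)
    have e1 : #(A₁ \ A) * K ^ a = #Z * K ^ (a + 1) := by rw [h4, pow_succ]; ring
    have e2 : #(O ∪ A₁) ≤ #(O ∪ A) + K * #Z := by
      rw [← h4]
      refine (card_le_card ?_).trans (card_union_le _ _)
      intro u; simp only [mem_union, mem_sdiff]; tauto
    -- All charges still point into `O ∪ A`, so the new layer is uncharged and `K ≤ D` is all that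
    -- the next layer needs.
    have hA₁ : ∀ u ∈ A₁, u ∉ O ∧ g₁ u ∈ O ∪ A := by
      intro u hu
      by_cases huA : u ∈ A
      · rw [h2 u huA]; exact hA u huA
      · have := h5 u (mem_sdiff.2 ⟨hu, huA⟩)
        exact ⟨this.1, hZO this.2.1⟩
    obtain ⟨A', g', Y, i1, i2, i3, i4, i5, i6, i7⟩ := ih h3 (Z := A₁ \ A)
      (fun u hu => mem_union_right _ (mem_sdiff.1 hu).1)
      (fun z hz => by
        have : {u ∈ A₁ | g₁ u = z} = ∅ := by
          rw [filter_eq_empty_iff]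
          rintro u hu rfl
          rcases mem_union.1 (hA₁ u hu).2 with h | h
          · exact (h5 _ hz).1 h
          · exact (mem_sdiff.1 hz).2 h
        rw [this]; simpa)
      (fun u hu => ⟨(hA₁ u hu).1, union_subset_union_right h1 (hA₁ u hu).2⟩)
      (by rw [e1, h4]; omega)
    have e3 : A' \ A = (A' \ A₁) ∪ (A₁ \ A) := by
      ext u; simp only [mem_union, mem_sdiff]; grind
    have e4 := card_union_le (A' \ A₁) (A₁ \ A)
    rw [← e3] at e4
    refine ⟨A', g', Y, h1.trans i1, fun u hu => by rw [i2 u (h1 hu), h2 u hu], i3, ?_, ?_, ?_, ?_⟩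
    · rw [e1] at i4; omega
    · intro u hu
      rw [e3] at hu ⊢
      rcases mem_union.1 hu with hu | hu
      · obtain ⟨j1, j2, j3⟩ := i5 u hu
        exact ⟨j1, Or.inr (mem_union.2 j2.symm), j3⟩
      · rw [i2 u (mem_sdiff.1 hu).1]
        obtain ⟨j1, j2, j3⟩ := h5 u hu
        exact ⟨j1, Or.inl j2, j3⟩
    · rw [i6, e1]
    · intro y hy
      obtain ⟨p, p1, p2, p3, p4⟩ := i7 y hy
      have p5 : ∀ i ≤ a, p i ∈ A' \ A := by
        intro i hi
        rw [e3]
        rcases i with _ | i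
        · exact mem_union_right _ p1
        · exact mem_union_left _ (p3 i hi).1
      have p6 : g' (p 0) ∈ Z := by
        rw [i2 _ (mem_sdiff.1 p1).1]; exact (h5 _ p1).2.1
      refine ⟨fun i => Nat.casesOn i (g' (p 0)) p, p6, p2, ?_, ?_⟩
      · rintro (_ | i) hi
        · exact ⟨p5 0 (by omega), rfl⟩
        · exact ⟨p5 (i + 1) (by omega), (p3 i (by omega)).2⟩
      · have hne : ∀ i ≤ a, p i ≠ g' (p 0) := by
          intro i hi heq
          have q1 := p5 i hi
          rw [heq] at q1
          rcases mem_union.1 (hZO p6) with q2 | q2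
          · rw [← heq] at q2
            rw [← heq, e3] at q1
            rcases mem_union.1 q1 with q1 | q1
            · exact (i5 _ q1).1 q2
            · exact (h5 _ q1).1 q2
          · exact (mem_sdiff.1 q1).2 q2
        rintro (_ | i) hi (_ | j) hj hij
        · rfl
        · exact absurd hij.symm (hne j (by simpa using hj))
        · exact absurd hij (hne i (by simpa using hi))
        · rw [p4 (by simpa using hi) (by simpa using hj) hij]

/-- `y` is a path of length `2 * a + 1` from `z` to a vertex of `B` through free vertices, which can
be added to `A` without violating the Friedman–Pippenger condition. -/
def IsLink (G : SimpleGraph V) [DecidableRel G.Adj] (O : Finset V) (D M : ℕ) (A : Finset V)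
    (g : V → V) (B : Finset V) (a : ℕ) (z : V) (y : ℕ → V) (g' : V → V) : Prop :=
  y 0 = z ∧ y (2 * a + 1) ∈ B ∧ (∀ i < 2 * a + 1, G.Adj (y i) (y (i + 1))) ∧
  (∀ i ∈ Icc 1 (2 * a), y i ∉ O ∪ A) ∧ Set.InjOn y (Icc 1 (2 * a)) ∧ (∀ u ∈ A, g' u = g u) ∧
  (∀ i ∈ Icc 1 (2 * a), g' (y i) = y (i - 1) ∨ g' (y i) = y (i + 1)) ∧
  Ext G O D M (A ∪ (Icc 1 (2 * a)).image y) g'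

/-- Grow forests of depth `a` from `s` vertices of `Z` and from `s` vertices of `B`. Each has `s * K
^ a ≥ m` end vertices, so an edge joins the two; the path through it is kept and the rest is
released by `Ext.mono`. The half grown from `B` is charged towards `B`, which is why `IsLink`
permits charges in both directions. -/
lemma Ext.exists_link (h : Ext G O D (2 * m) A g) (hJ : Joined G m) (hm : 0 < m) (hK : 2 ≤ K)
    (hKD : K ≤ D) {a s : ℕ} {Z B : Finset V} (hZO : Z ⊆ O ∪ A) (hBO : B ⊆ O)
    (hZB : Disjoint Z B) (hA : ∀ u ∈ A, u ∉ O ∧ g u ∈ O ∪ A ∧ G.Adj (g u) u)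
    (hZ : ∀ z ∈ Z, #{u ∈ A | g u = z} + K ≤ D) (hB : ∀ u ∈ A, g u ∉ B)
    (hZs : s ≤ #Z) (hBs : s ≤ #B) (hs : m ≤ s * K ^ a)
    (hcap : #(O ∪ A) + 4 * (s * K ^ a) + m + 2 * m * D < Fintype.card V) :
    ∃ z ∈ Z, ∃ y g', IsLink G O D (2 * m) A g B a z y g' := by
  obtain ⟨Z₀, hZ₀, hZc⟩ := exists_subset_card_eq hZs
  obtain ⟨B₀, hB₀, hBc⟩ := exists_subset_card_eq hBs
  obtain ⟨A₁, g₁, Y₁, h1, h2, h3, h4, h5, h6, h7⟩ := Ext.grow_forest hJ hm hK hKD a h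
    (hZ₀.trans hZO) (fun z hz => hZ z (hZ₀ hz)) (fun u hu => ⟨(hA u hu).1, (hA u hu).2.1⟩)
    (by rw [hZc]; omega)
  have e1 : #(O ∪ A₁) ≤ #(O ∪ A) + #(A₁ \ A) := by
    refine (card_le_card ?_).trans (card_union_le _ _)
    intro u; simp only [mem_union, mem_sdiff]; tauto
  have hB₁ : ∀ u ∈ A₁, g₁ u ∉ B := by
    intro u hu hgB
    by_cases huA : u ∈ A
    · rw [h2 u huA] at hgB; exact hB u huA hgB
    · obtain ⟨j1, j2, j3⟩ := h5 u (mem_sdiff.2 ⟨hu, huA⟩)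
      rcases j2 with j2 | j2
      · exact disjoint_left.1 hZB (hZ₀ j2) hgB
      · exact (h5 _ j2).1 (hBO hgB)
  have hA₁ : ∀ u ∈ A₁, u ∉ O ∧ g₁ u ∈ O ∪ A₁ := by
    intro u hu
    by_cases huA : u ∈ A
    · rw [h2 u huA]
      exact ⟨(hA u huA).1, union_subset_union_right h1 (hA u huA).2.1⟩
    · obtain ⟨j1, j2, j3⟩ := h5 u (mem_sdiff.2 ⟨hu, huA⟩)
      refine ⟨j1, ?_⟩
      rcases j2 with j2 | j2
      · exact union_subset_union_right h1 (hZO (hZ₀ j2))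
      · exact mem_union_right _ (mem_sdiff.1 j2).1
  obtain ⟨A₂, g₂, Y₂, i1, i2, i3, i4, i5, i6, i7⟩ := Ext.grow_forest hJ hm hK hKD a h3
    (Z := B₀) ((hB₀.trans hBO).trans subset_union_left)
    (fun z hz => by
      have : {u ∈ A₁ | g₁ u = z} = ∅ := by
        rw [filter_eq_empty_iff]
        rintro u hu rfl
        exact hB₁ u hu (hB₀ hz)
      rw [this]; simpa) hA₁
    (by rw [hBc]; rw [hZc] at h4; omega)
  obtain ⟨y₁, hy₁, y₂, hy₂, hadj⟩ := hJ Y₁ Y₂ (by rw [h6, hZc]; exact hs) (by rw [i6, hBc]; exact hs)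
  obtain ⟨p, p1, p2, p3, p4⟩ := h7 y₁ hy₁
  obtain ⟨q, q1, q2, q3, q4⟩ := i7 y₂ hy₂
  have hA₂ : ∀ u ∈ A₂, u ∉ O ∧ G.Adj (g₂ u) u := by
    intro u hu
    by_cases hu1 : u ∈ A₁
    · rw [i2 u hu1]
      by_cases huA : u ∈ A
      · rw [h2 u huA]; exact ⟨(hA u huA).1, (hA u huA).2.2⟩
      · have := h5 u (mem_sdiff.2 ⟨hu1, huA⟩); exact ⟨this.1, this.2.2⟩
    · have := i5 u (mem_sdiff.2 ⟨hu, hu1⟩); exact ⟨this.1, this.2.2⟩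
  have p5 : ∀ i, 1 ≤ i → i ≤ a → p i ∈ A₁ ∧ p i ∉ A ∧ g₂ (p i) = p (i - 1) := by
    intro i hi1 hi2
    obtain ⟨i, rfl⟩ : ∃ j, i = j + 1 := ⟨i - 1, by omega⟩
    obtain ⟨r1, r2⟩ := p3 i (by omega)
    exact ⟨(mem_sdiff.1 r1).1, (mem_sdiff.1 r1).2, by rw [i2 _ (mem_sdiff.1 r1).1, r2]; rfl⟩
  have q5 : ∀ i, 1 ≤ i → i ≤ a → q i ∈ A₂ ∧ q i ∉ A₁ ∧ g₂ (q i) = q (i - 1) := by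
    intro i hi1 hi2
    obtain ⟨i, rfl⟩ : ∃ j, i = j + 1 := ⟨i - 1, by omega⟩
    obtain ⟨r1, r2⟩ := q3 i (by omega)
    exact ⟨(mem_sdiff.1 r1).1, (mem_sdiff.1 r1).2, r2⟩
  set y : ℕ → V := fun i => if i ≤ a then p i else q (2 * a + 1 - i) with hy
  have yl : ∀ i, i ≤ a → y i = p i := fun i hi => by simp [hy, hi]
  have yr : ∀ i, a < i → y i = q (2 * a + 1 - i) := fun i hi => by simp [hy, not_le.2 hi]
  have hmem : ∀ i ∈ Icc 1 (2 * a), y i ∈ A₂ ∧ y i ∉ A := by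
    intro i hi
    rw [mem_Icc] at hi
    by_cases hia : i ≤ a
    · rw [yl i hia]; exact ⟨i1 (p5 i hi.1 hia).1, (p5 i hi.1 hia).2.1⟩
    · rw [yr i (by omega)]
      have := q5 (2 * a + 1 - i) (by omega) (by omega)
      exact ⟨this.1, fun h => this.2.1 (h1 h)⟩
  refine ⟨p 0, hZ₀ p1, y, g₂, yl 0 (by omega), ?_, ?_, ?_, ?_, ?_, ?_, ?_⟩
  · rw [yr _ (by omega)]; simpa using hB₀ q1
  · intro i hi
    rcases lt_trichotomy i a with hia | rfl | hia
    · rw [yl i hia.le, yl (i + 1) hia]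
      obtain ⟨r1, r2, r3⟩ := p5 (i + 1) (by omega) hia
      have := (hA₂ _ (i1 r1)).2
      rwa [r3] at this
    · rw [yl i le_rfl, yr (i + 1) (by omega), p2]
      have : 2 * i + 1 - (i + 1) = i := by omega
      rw [this, q2]; exact hadj
    · rw [yr i hia, yr (i + 1) (by omega)]
      obtain ⟨r1, r2, r3⟩ := q5 (2 * a + 1 - i) (by omega) (by omega)
      have := (hA₂ _ r1).2
      rw [r3] at this
      exact this.symm
  · intro i hi h
    rcases mem_union.1 h with h | h
    · exact (hA₂ _ (hmem i hi).1).1 h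
    · exact (hmem i hi).2 h
  · intro i hi j hj hij
    simp only [coe_Icc, Set.mem_Icc] at hi hj
    by_cases hia : i ≤ a <;> by_cases hja : j ≤ a
    · rw [yl i hia, yl j hja] at hij
      exact p4 hia hja hij
    · rw [yl i hia, yr j (by omega)] at hij
      have := (q5 (2 * a + 1 - j) (by omega) (by omega)).2.1
      rw [← hij] at this
      exact absurd (p5 i hi.1 hia).1 this
    · rw [yl j hja, yr i (by omega)] at hij
      have := (q5 (2 * a + 1 - i) (by omega) (by omega)).2.1
      rw [hij] at this
      exact absurd (p5 j hj.1 hja).1 this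
    · rw [yr i (by omega), yr j (by omega)] at hij
      have := q4 (x₁ := 2 * a + 1 - i) (by simp; omega) (x₂ := 2 * a + 1 - j) (by simp; omega) hij
      omega
  · intro u hu
    rw [i2 u (h1 hu), h2 u hu]
  · intro i hi
    rw [mem_Icc] at hi
    by_cases hia : i ≤ a
    · left
      rw [yl i hia, yl (i - 1) (by omega)]; exact (p5 i hi.1 hia).2.2
    · right
      rw [yr i (by omega), yr (i + 1) (by omega)]
      exact (q5 (2 * a + 1 - i) (by omega) (by omega)).2.2
  · refine i3.mono ?_ (fun u hu => (hA₂ u hu).2)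
      (disjoint_left.2 fun u hu => (hA₂ u hu).1)
    intro u hu
    rcases mem_union.1 hu with hu | hu
    · exact i1 (h1 hu)
    · obtain ⟨i, hi, rfl⟩ := mem_image.1 hu
      exact (hmem i hi).1

/-- A link for a larger occupied set is a link for a smaller one. -/
lemma IsLink.anti {B B' : Finset V} {a : ℕ} {z : V} {y : ℕ → V} {g₁ : V → V}
    (h : IsLink G O D M A' g' B' a z y g₁) (hA : A ⊆ A') (hB : B' ⊆ B)
    (hg : ∀ u ∈ A, g' u = g u) (hadj : ∀ u ∈ A', u ∉ O ∧ G.Adj (g' u) u) :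
    IsLink G O D M A g B a z y g₁ := by
  obtain ⟨h1, h2, h3, h4, h5, h6, h7, h8⟩ := h
  refine ⟨h1, hB h2, h3, fun i hi h => h4 i hi (union_subset_union_right hA h), h5,
    fun u hu => by rw [h6 u (hA hu), hg u hu], h7, ?_⟩
  refine h8.mono (union_subset_union_left hA) ?_ ?_
  · intro u hu
    rcases mem_union.1 hu with hu | hu
    · rw [h6 u hu]; exact (hadj u hu).2
    · obtain ⟨i, hi, rfl⟩ := mem_image.1 hu
      have hi' := mem_Icc.1 hi
      rcases h7 i hi with h | h
      · rw [h]
        have := h3 (i - 1) (by omega)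
        rwa [Nat.sub_add_cancel hi'.1] at this
      · rw [h]; exact (h3 i (by omega)).symm
  · rw [disjoint_left]
    intro u hu
    rcases mem_union.1 hu with hu | hu
    · exact (hadj u hu).1
    · obtain ⟨i, hi, rfl⟩ := mem_image.1 hu
      exact fun h => h4 i hi (mem_union_left _ h)

/-! ### Rooted trees and ancestors. -/

/-- A rooted tree given by its parent function and depth function. -/
structure RootedTree (W : Type*) where
  root : W
  par : W → W
  dep : W → ℕ
  par_root : par root = root
  dep_root : dep root = 0
  dep_par : ∀ w, w ≠ root → dep w = dep (par w) + 1

namespace RootedTree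

variable {W : Type*} (T : RootedTree W)

lemma ne_root_of_dep_pos {w : W} (h : 0 < T.dep w) : w ≠ T.root := by
  rintro rfl; rw [T.dep_root] at h; omega

lemma dep_pos {w : W} (h : w ≠ T.root) : 0 < T.dep w := by
  have := T.dep_par w h; omega

lemma dep_iterate {w : W} {i : ℕ} (hi : i ≤ T.dep w) : T.dep (T.par^[i] w) + i = T.dep w := by
  induction i with
  | zero => rfl
  | succ i ih =>
    have h1 := ih (by omega)
    rw [Function.iterate_succ_apply']
    have h2 := T.dep_par (T.par^[i] w) (T.ne_root_of_dep_pos (by omega))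
    omega

lemma iterate_dep (w : W) : T.par^[T.dep w] w = T.root := by
  by_contra h
  have h1 := T.dep_pos h
  have h2 := T.dep_iterate (w := w) le_rfl
  omega

variable [DecidableEq W]

/-- The vertices on the path from `w` to the root. -/
def anc (w : W) : Finset W := (range (T.dep w + 1)).image fun i => T.par^[i] w

lemma mem_anc {v w : W} : v ∈ T.anc w ↔ ∃ i ≤ T.dep w, T.par^[i] w = v := by
  simp [anc]

lemma self_mem_anc (w : W) : w ∈ T.anc w := T.mem_anc.2 ⟨0, by omega, rfl⟩

lemma root_mem_anc (w : W) : T.root ∈ T.anc w := T.mem_anc.2 ⟨_, le_rfl, T.iterate_dep w⟩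

lemma dep_le_of_mem_anc {v w : W} (h : v ∈ T.anc w) : T.dep v ≤ T.dep w := by
  obtain ⟨i, hi, rfl⟩ := T.mem_anc.1 h
  have := T.dep_iterate hi
  omega

lemma iterate_of_mem_anc {v w : W} (h : v ∈ T.anc w) : T.par^[T.dep w - T.dep v] w = v := by
  obtain ⟨i, hi, rfl⟩ := T.mem_anc.1 h
  have := T.dep_iterate hi
  congr 2
  omega

lemma anc_root : T.anc T.root = {T.root} := by
  simp [anc, T.dep_root]

lemma anc_eq_insert {w : W} (h : w ≠ T.root) : T.anc w = insert w (T.anc (T.par w)) := by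
  ext v
  simp only [mem_insert, mem_anc]
  have := T.dep_par w h
  constructor
  · rintro ⟨i | i, hi, rfl⟩
    · exact Or.inl rfl
    · exact Or.inr ⟨i, by omega, rfl⟩
  · rintro (rfl | ⟨i, hi, rfl⟩)
    · exact ⟨0, by omega, rfl⟩
    · exact ⟨i + 1, by omega, rfl⟩

lemma anc_trans {u v w : W} (h1 : u ∈ T.anc v) (h2 : v ∈ T.anc w) : u ∈ T.anc w := by
  obtain ⟨i, hi, rfl⟩ := T.mem_anc.1 h1
  obtain ⟨j, hj, rfl⟩ := T.mem_anc.1 h2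
  have := T.dep_iterate hj
  exact T.mem_anc.2 ⟨i + j, by omega, Function.iterate_add_apply _ _ _ _⟩

lemma mem_anc_of_dep_le {u v w : W} (hu : u ∈ T.anc w) (hv : v ∈ T.anc w)
    (h : T.dep u ≤ T.dep v) : u ∈ T.anc v := by
  obtain ⟨i, hi, rfl⟩ := T.mem_anc.1 hu
  obtain ⟨j, hj, rfl⟩ := T.mem_anc.1 hv
  have h1 := T.dep_iterate hi
  have h2 := T.dep_iterate hj
  refine T.mem_anc.2 ⟨i - j, by omega, ?_⟩
  rw [← Function.iterate_add_apply]
  congr 2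
  omega

lemma anc_subset_of_closed {E : Finset W} (hE : ∀ w ∈ E, T.par w ∈ E) {w : W} (hw : w ∈ E) :
    T.anc w ⊆ E := by
  intro v hv
  obtain ⟨i, _, rfl⟩ := T.mem_anc.1 hv
  clear hv
  induction i with
  | zero => exact hw
  | succ i ih => rw [Function.iterate_succ_apply']; exact hE _ (ih (by omega))

end RootedTree

/-! ### Partial embeddings and their extensions. -/

/-- A partial embedding `φ` of a rooted tree, defined on `E`, with the set `A` of occupied vertices
and their charges `g`. -/
structure PartialEmbedding (V W : Type*) where
  E : Finset W
  φ : W → V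
  A : Finset V
  g : V → V

namespace PartialEmbedding

variable {V W : Type*} [Fintype V] [DecidableEq V] [Fintype W] [DecidableEq W]

/-- The partial embedding maps edges to edges, maps a vertex to the reserved set `R` only if it
is in `P`, otherwise avoids `O`, and the Friedman–Pippenger condition holds. -/
structure Valid (T : RootedTree W) (G : SimpleGraph V) [DecidableRel G.Adj] (O R : Finset V)
    (x₀ : V) (P : Finset W) (D M : ℕ) (s : PartialEmbedding V W) : Prop where
  root_mem : T.root ∈ s.E
  map_root : s.φ T.root = x₀
  par_mem : ∀ w ∈ s.E, T.par w ∈ s.E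
  inj : Set.InjOn s.φ s.E
  adj : ∀ w ∈ s.E, w ≠ T.root → G.Adj (s.φ (T.par w)) (s.φ w)
  notMem : ∀ u ∈ s.A, u ∉ O
  cover : ∀ w ∈ s.E, s.φ w ∈ s.A ∨ (s.φ w ∈ R ∧ w ∈ P) ∨ w = T.root
  exists_eq : ∀ u ∈ s.A, ∃ w ∈ s.E, s.φ w = u
  charge : ∀ w ∈ s.E, s.φ w ∈ s.A → ∃ w' ∈ s.E, s.g (s.φ w) = s.φ w' ∧
    (w' = T.par w ∨ (T.par w' = w ∧ w' ≠ T.root))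
  ext : Ext G O D M s.A s.g

/-- The second partial embedding extends the first. -/
structure Extends (s t : PartialEmbedding V W) : Prop where
  E_subset : s.E ⊆ t.E
  φ_eq : ∀ w ∈ s.E, t.φ w = s.φ w
  A_subset : s.A ⊆ t.A
  g_eq : ∀ u ∈ s.A, t.g u = s.g u

lemma Extends.refl (s : PartialEmbedding V W) : s.Extends s :=
  ⟨Subset.rfl, fun _ _ => rfl, Subset.rfl, fun _ _ => rfl⟩

lemma Extends.trans {s t u : PartialEmbedding V W} (h1 : s.Extends t) (h2 : t.Extends u) :
    s.Extends u :=
  ⟨h1.E_subset.trans h2.E_subset, fun w hw => by rw [h2.φ_eq w (h1.E_subset hw), h1.φ_eq w hw],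
    h1.A_subset.trans h2.A_subset, fun w hw => by rw [h2.g_eq w (h1.A_subset hw), h1.g_eq w hw]⟩

/-- The vertices of `R` that are not in the image. -/
def uncovered (R : Finset V) (s : PartialEmbedding V W) : Finset V := R \ s.E.image s.φ

lemma Extends.uncovered_subset {R : Finset V} {s t : PartialEmbedding V W} (h : s.Extends t) :
    t.uncovered R ⊆ s.uncovered R := by
  intro b hb
  simp only [uncovered, mem_sdiff, mem_image, not_exists, not_and] at hb ⊢
  exact ⟨hb.1, fun w hw => by rw [← h.φ_eq w hw]; exact hb.2 w (h.E_subset hw)⟩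

variable {T : RootedTree W} {G : SimpleGraph V} [DecidableRel G.Adj] {O R : Finset V} {x₀ : V}
  {P : Finset W} {D M m K Δ : ℕ} {s : PartialEmbedding V W}

lemma Valid.notMem_R (h : s.Valid T G O R x₀ P D M) (hR : R ⊆ O) {u : V} (hu : u ∈ s.A) : u ∉ R :=
  fun h' => h.notMem u hu (hR h')

lemma Valid.mem_O (h : s.Valid T G O R x₀ P D M) (hR : R ⊆ O) (hx : x₀ ∈ O) {w : W}
    (hw : w ∈ s.E) : s.φ w ∈ O ∪ s.A := by
  rcases h.cover w hw with h1 | h1 | rfl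
  · exact mem_union_right _ h1
  · exact mem_union_left _ (hR h1.1)
  · rw [h.map_root]; exact mem_union_left _ hx

lemma Valid.map_mem_R (h : s.Valid T G O R x₀ P D M) (hR : R ⊆ O) (hxR : x₀ ∉ R) {w : W}
    (hw : w ∈ s.E) (hwR : s.φ w ∈ R) : w ∈ P := by
  rcases h.cover w hw with h1 | h1 | rfl
  · exact absurd hwR (h.notMem_R hR h1)
  · exact h1.2
  · rw [h.map_root] at hwR; exact absurd hwR hxR

lemma Valid.g_spec (h : s.Valid T G O R x₀ P D M) (hx : x₀ ∈ O) {u : V} (hu : u ∈ s.A) :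
    ∃ w ∈ s.E, s.g u = s.φ w ∧ G.Adj (s.g u) u := by
  obtain ⟨w, hw, rfl⟩ := h.exists_eq u hu
  obtain ⟨w', hw', hg, h1⟩ := h.charge w hw hu
  refine ⟨w', hw', hg, ?_⟩
  rw [hg]
  rcases h1 with rfl | ⟨rfl, h2⟩
  · refine h.adj w hw ?_
    rintro rfl
    rw [h.map_root] at hu
    exact h.notMem _ hu hx
  · exact (h.adj w' hw' h2).symm

/-- Only tree neighbours charge the image of `w`: its children, and possibly its parent when that
lies in the second half of a link. Hence `Δ + 1`, which leaves `K` units of demand for growing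
forests when `Δ + 1 + K ≤ D`. -/
lemma Valid.card_charge_le (h : s.Valid T G O R x₀ P D M) (hx : x₀ ∈ O)
    (hΔ : ∀ w, #{v | v ≠ T.root ∧ T.par v = w} ≤ Δ) {w : W} (hw : w ∈ s.E) :
    #{u ∈ s.A | s.g u = s.φ w} ≤ Δ + 1 := by
  have h1 : {u ∈ s.A | s.g u = s.φ w} ⊆
      Finset.image s.φ (insert (T.par w) ({v | v ≠ T.root ∧ T.par v = w} : Finset W)) := by
    intro u hu
    obtain ⟨huA, hgu⟩ := mem_filter.1 hu
    clear hu
    obtain ⟨v, hv, rfl⟩ := h.exists_eq u huA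
    obtain ⟨w', hw', hg, h1⟩ := h.charge v hv huA
    have : w' = w := h.inj hw' hw (by rw [← hg, hgu])
    subst this
    refine mem_image_of_mem _ ?_
    rcases h1 with rfl | ⟨rfl, h2⟩
    · refine mem_insert_of_mem ?_
      simp only [mem_filter, mem_univ, true_and, and_true]
      rintro rfl
      rw [h.map_root] at huA
      exact h.notMem _ huA hx
    · exact mem_insert_self _ _
  refine (card_le_card h1).trans (card_image_le.trans ((card_insert_le _ _).trans ?_))
  have := hΔ w
  omega

lemma Valid.card_le (h : s.Valid T G O R x₀ P D M) : #(O ∪ s.A) ≤ #O + Fintype.card W := by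
  refine (card_union_le _ _).trans ?_
  gcongr
  have : s.A ⊆ s.E.image s.φ := fun u hu => by
    obtain ⟨w, hw, rfl⟩ := h.exists_eq u hu
    exact mem_image_of_mem _ hw
  exact (card_le_card this).trans (card_image_le.trans (card_le_univ _))

/-- Embed one more vertex. -/
lemma Valid.extend_one (h : s.Valid T G O R x₀ P D (2 * m)) (hR : R ⊆ O) (hx : x₀ ∈ O)
    (hΔ : ∀ w, #{v | v ≠ T.root ∧ T.par v = w} ≤ Δ) (hD : Δ + 1 < D)
    (hJ : Joined G m) (hm : 0 < m)
    (hcap : #O + Fintype.card W + m + 2 * m * D < Fintype.card V)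
    {w : W} (hw : w ∉ s.E) (hpw : T.par w ∈ s.E) :
    ∃ t : PartialEmbedding V W, t.Valid T G O R x₀ P D (2 * m) ∧ s.Extends t ∧ t.E = insert w s.E ∧
      t.uncovered R = s.uncovered R := by
  have hcard := h.card_le
  obtain ⟨u, hu, hadj, hE⟩ := h.ext.extend hJ hm (by omega) (y := s.φ (T.par w))
    (lt_of_le_of_lt (h.card_charge_le hx hΔ hpw) hD)
  have huA : u ∉ s.A := fun h => hu (mem_union_right _ h)
  have huO : u ∉ O := fun h => hu (mem_union_left _ h)
  have hne : ∀ v ∈ s.E, v ≠ w := by rintro v hv rfl; exact hw hv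
  have hφ : ∀ v ∈ s.E, Function.update s.φ w u v = s.φ v := fun v hv =>
    Function.update_of_ne (hne v hv) _ _
  have hg : ∀ v ∈ s.A, Function.update s.g u (s.φ (T.par w)) v = s.g v := fun v hv =>
    Function.update_of_ne (by rintro rfl; exact huA hv) _ _
  have hun : ∀ v ∈ s.E, s.φ v ≠ u := by rintro v hv rfl; exact hu (h.mem_O hR hx hv)
  have hwr : w ≠ T.root := (hne _ h.root_mem).symm
  refine ⟨⟨insert w s.E, Function.update s.φ w u, insert u s.A,
    Function.update s.g u (s.φ (T.par w))⟩, ?_, ⟨subset_insert _ _, hφ, subset_insert _ _, hg⟩,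
    rfl, ?_⟩
  · constructor
    · exact mem_insert_of_mem h.root_mem
    · simp only; rw [hφ _ h.root_mem, h.map_root]
    · intro v hv
      rcases mem_insert.1 hv with rfl | hv
      · exact mem_insert_of_mem hpw
      · exact mem_insert_of_mem (h.par_mem v hv)
    · intro v hv v' hv' hvv
      simp only [coe_insert, Set.mem_insert_iff, mem_coe] at hv hv' hvv
      rcases hv with rfl | hv <;> rcases hv' with rfl | hv'
      · rfl
      · rw [hφ v' hv', Function.update_self] at hvv
        exact absurd hvv.symm (hun v' hv')
      · rw [hφ v hv, Function.update_self] at hvv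
        exact absurd hvv (hun v hv)
      · rw [hφ v hv, hφ v' hv'] at hvv
        exact h.inj hv hv' hvv
    · intro v hv hvr
      simp only
      rcases mem_insert.1 hv with rfl | hv
      · rw [hφ _ hpw, Function.update_self]; exact hadj
      · rw [hφ _ (h.par_mem v hv), hφ _ hv]; exact h.adj v hv hvr
    · intro v hv
      rcases mem_insert.1 hv with rfl | hv
      · exact huO
      · exact h.notMem v hv
    · intro v hv
      simp only
      rcases mem_insert.1 hv with rfl | hv
      · rw [Function.update_self]; exact Or.inl (mem_insert_self _ _)
      · rw [hφ v hv]
        exact (h.cover v hv).imp_left mem_insert_of_mem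
    · intro v hv
      simp only
      rcases mem_insert.1 hv with rfl | hv
      · exact ⟨w, mem_insert_self _ _, Function.update_self ..⟩
      · obtain ⟨v', hv', rfl⟩ := h.exists_eq v hv
        exact ⟨v', mem_insert_of_mem hv', hφ v' hv'⟩
    · intro v hv hvA
      simp only at hvA ⊢
      rcases mem_insert.1 hv with rfl | hv
      · exact ⟨T.par v, mem_insert_of_mem hpw, by rw [hφ _ hpw]; simp, Or.inl rfl⟩
      · rw [hφ v hv] at hvA ⊢
        have hvA := mem_of_mem_insert_of_ne hvA (hun v hv)
        obtain ⟨w', hw', h1, h2⟩ := h.charge v hv hvA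
        exact ⟨w', mem_insert_of_mem hw', by rw [hg _ hvA, h1, hφ _ hw'], h2⟩
    · exact hE
  · simp only [uncovered]
    rw [image_insert, Function.update_self]
    have : s.E.image (Function.update s.φ w u) = s.E.image s.φ := image_congr hφ
    rw [this]
    ext b
    simp only [mem_sdiff, mem_insert, not_or]
    constructor
    · rintro ⟨h1, h2, h3⟩; exact ⟨h1, h3⟩
    · rintro ⟨h1, h3⟩; exact ⟨h1, by rintro rfl; exact huO (hR h1), h3⟩

/-- Embed a vertex together with all its ancestors. -/
lemma Valid.extend_anc (h : s.Valid T G O R x₀ P D (2 * m)) (hR : R ⊆ O) (hx : x₀ ∈ O)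
    (hΔ : ∀ w, #{v | v ≠ T.root ∧ T.par v = w} ≤ Δ) (hD : Δ + 1 < D)
    (hJ : Joined G m) (hm : 0 < m)
    (hcap : #O + Fintype.card W + m + 2 * m * D < Fintype.card V) (w : W) :
    ∃ t : PartialEmbedding V W, t.Valid T G O R x₀ P D (2 * m) ∧ s.Extends t ∧
      t.E = s.E ∪ T.anc w ∧ t.uncovered R = s.uncovered R := by
  induction hn : T.dep w generalizing w with
  | zero =>
    have hw : w = T.root := by
      by_contra h; have := T.dep_pos h; omega
    subst hw
    refine ⟨s, h, .refl s, ?_, rfl⟩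
    rw [T.anc_root, eq_comm, union_eq_left]
    simpa using h.root_mem
  | succ n ih =>
    have hw := T.ne_root_of_dep_pos (w := w) (by omega)
    obtain ⟨t, h1, h2, h3, h4⟩ := ih (T.par w) (by have := T.dep_par w hw; omega)
    by_cases hwt : w ∈ t.E
    · refine ⟨t, h1, h2, ?_, h4⟩
      rw [h3, T.anc_eq_insert hw]
      rw [h3] at hwt
      ext v; simp only [mem_union, mem_insert] at hwt ⊢
      constructor
      · tauto
      · rintro (h | rfl | h) <;> tauto
    · obtain ⟨t', i1, i2, i3, i4⟩ := h1.extend_one hR hx hΔ hD hJ hm hcap hwt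
        (by rw [h3]; exact mem_union_right _ (T.self_mem_anc _))
      refine ⟨t', i1, h2.trans i2, ?_, i4.trans h4⟩
      rw [i3, h3, T.anc_eq_insert hw, union_insert]

/-- Embed the path above `q` along a link to an uncovered vertex of `R`. -/
lemma Valid.extend_link (h : s.Valid T G O R x₀ P D M) (hR : R ⊆ O) (hx : x₀ ∈ O)
    {q : W} {a : ℕ} (hq : 2 * a + 1 ≤ T.dep q) (hqP : q ∈ P)
    (hz : T.par^[2 * a + 1] q ∈ s.E) (hnew : ∀ i ≤ 2 * a, T.par^[i] q ∉ s.E)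
    {y : ℕ → V} {g' : V → V}
    (hy : IsLink G O D M s.A s.g (s.uncovered R) a (s.φ (T.par^[2 * a + 1] q)) y g') :
    ∃ t : PartialEmbedding V W, t.Valid T G O R x₀ P D M ∧ s.Extends t ∧
      t.E = s.E ∪ T.anc q ∧ #(t.uncovered R) + 1 = #(s.uncovered R) := by
  obtain ⟨y1, y2, y3, y4, y5, y6, y7, y8⟩ := hy
  set z := T.par^[2 * a + 1] q with hzdef
  have hdz : T.dep z + (2 * a + 1) = T.dep q := T.dep_iterate hq
  set φ' : W → V := fun w => if w ∈ s.E then s.φ w else y (T.dep w - T.dep z) with hφ'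
  have hφ : ∀ v ∈ s.E, φ' v = s.φ v := fun v hv => by simp [hφ', hv]
  -- The tree path from `z` down to `q`, indexed so that `c i` is placed on `y i`.
  set c : ℕ → W := fun i => T.par^[2 * a + 1 - i] q with hc
  have hc0 : c 0 = z := rfl
  have hcpar : ∀ i < 2 * a + 1, T.par (c (i + 1)) = c i := by
    intro i hi
    simp only [hc]
    rw [← Function.iterate_succ_apply' T.par]
    congr 2; omega
  have hcd : ∀ i ≤ 2 * a + 1, T.dep (c i) = T.dep z + i := by
    intro i hi
    have := T.dep_iterate (w := q) (i := 2 * a + 1 - i) (by omega)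
    simp only [hc]; omega
  have hcE : ∀ i, 1 ≤ i → i ≤ 2 * a + 1 → c i ∉ s.E := fun i hi hi' => hnew _ (by omega)
  have hcφ : ∀ i ≤ 2 * a + 1, φ' (c i) = y i := by
    intro i hi
    rcases Nat.eq_zero_or_pos i with rfl | hi0
    · rw [hc0, hφ z hz, y1]
    · simp only [hφ', if_neg (hcE i hi0 hi)]
      rw [hcd i hi]; congr 1; omega
  have hcr : ∀ i, 1 ≤ i → i ≤ 2 * a + 1 → c i ≠ T.root := fun i hi hi' =>
    T.ne_root_of_dep_pos (by rw [hcd i hi']; omega)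
  have hbR : y (2 * a + 1) ∈ R ∧ ∀ w ∈ s.E, s.φ w ≠ y (2 * a + 1) := by
    simpa [uncovered] using y2
  set A' := s.A ∪ (Icc 1 (2 * a)).image y with hA'
  have hyO : ∀ i, 1 ≤ i → i ≤ 2 * a → y i ∉ O ∪ s.A := fun i hi hi' => y4 i (mem_Icc.2 ⟨hi, hi'⟩)
  have hyE : ∀ i, 1 ≤ i → i ≤ 2 * a + 1 → ∀ w ∈ s.E, s.φ w ≠ y i := by
    intro i hi hi' w hw heq
    rcases Nat.lt_or_ge (2 * a) i with h1 | h1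
    · have : i = 2 * a + 1 := by omega
      subst this
      exact hbR.2 w hw heq
    · exact hyO i hi h1 (heq ▸ h.mem_O hR hx hw)
  have hyinj : ∀ i j, 1 ≤ i → i ≤ 2 * a + 1 → 1 ≤ j → j ≤ 2 * a + 1 → y i = y j → i = j := by
    -- Interior vertices of the link avoid `O`, while its end lies in `R ⊆ O`.
    have aux : ∀ i, 1 ≤ i → i ≤ 2 * a → y i ≠ y (2 * a + 1) := by
      intro i h1 h2 heq
      exact hyO i h1 h2 (mem_union_left _ (heq ▸ hR hbR.1))
    intro i j h1 h2 h3 h4 heq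
    rcases Nat.lt_or_ge (2 * a) i with h5 | h5 <;> rcases Nat.lt_or_ge (2 * a) j with h6 | h6
    · omega
    · have : i = 2 * a + 1 := by omega
      subst this
      exact absurd heq.symm (aux j h3 h6)
    · have : j = 2 * a + 1 := by omega
      subst this
      exact absurd heq (aux i h1 h5)
    · exact y5 (by simp; omega) (by simp; omega) heq
  set E' := s.E ∪ (Icc 1 (2 * a + 1)).image c with hE'
  have hEanc : E' = s.E ∪ T.anc q := by
    ext v
    simp only [hE', mem_union, mem_image, mem_Icc, T.mem_anc]
    constructor
    · rintro (h1 | ⟨i, hi, rfl⟩)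
      · exact Or.inl h1
      · exact Or.inr ⟨2 * a + 1 - i, by omega, rfl⟩
    · rintro (h1 | ⟨i, hi, rfl⟩)
      · exact Or.inl h1
      · by_cases hia : i ≤ 2 * a
        · right
          refine ⟨2 * a + 1 - i, by omega, ?_⟩
          simp only [hc]; congr 2; omega
        · left
          refine T.anc_subset_of_closed h.par_mem hz (T.mem_anc.2 ⟨i - (2 * a + 1), by omega, ?_⟩)
          rw [hzdef, ← Function.iterate_add_apply]
          congr 2; omega
  have hcases : ∀ v ∈ E', v ∈ s.E ∨ ∃ i, 1 ≤ i ∧ i ≤ 2 * a + 1 ∧ c i = v := by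
    intro v hv
    rcases mem_union.1 hv with hv | hv
    · exact Or.inl hv
    · obtain ⟨i, hi, rfl⟩ := mem_image.1 hv
      exact Or.inr ⟨i, (mem_Icc.1 hi).1, (mem_Icc.1 hi).2, rfl⟩
  have hcE' : ∀ i ≤ 2 * a + 1, c i ∈ E' := by
    intro i hi
    rcases Nat.eq_zero_or_pos i with rfl | hi0
    · exact mem_union_left _ hz
    · exact mem_union_right _ (mem_image_of_mem _ (mem_Icc.2 ⟨hi0, hi⟩))
  have himage : E'.image φ' = s.E.image s.φ ∪ (Icc 1 (2 * a + 1)).image y := by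
    rw [hE', image_union, image_image]
    congr 1
    · exact image_congr hφ
    · refine image_congr fun i hi => ?_
      simp only [coe_Icc, Set.mem_Icc] at hi
      exact hcφ i hi.2
  refine ⟨⟨E', φ', A', g'⟩, ?_, ⟨subset_union_left, hφ, subset_union_left, y6⟩, hEanc, ?_⟩
  · constructor
    · exact mem_union_left _ h.root_mem
    · simp only; rw [hφ _ h.root_mem, h.map_root]
    · intro v hv
      rcases hcases v hv with hv | ⟨i, hi1, hi2, rfl⟩
      · exact mem_union_left _ (h.par_mem v hv)
      · obtain ⟨i, rfl⟩ : ∃ j, i = j + 1 := ⟨i - 1, by omega⟩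
        rw [hcpar i (by omega)]
        exact hcE' i (by omega)
    · intro v hv v' hv' hvv
      simp only at hvv
      rcases hcases v hv with hv | ⟨i, hi1, hi2, rfl⟩ <;>
        rcases hcases v' hv' with hv' | ⟨j, hj1, hj2, rfl⟩
      · rw [hφ v hv, hφ v' hv'] at hvv; exact h.inj hv hv' hvv
      · rw [hφ v hv, hcφ j hj2] at hvv
        exact absurd hvv (hyE j hj1 hj2 v hv)
      · rw [hφ v' hv', hcφ i hi2] at hvv
        exact absurd hvv.symm (hyE i hi1 hi2 v' hv')
      · rw [hcφ i hi2, hcφ j hj2] at hvv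
        rw [hyinj i j hi1 hi2 hj1 hj2 hvv]
    · intro v hv hvr
      simp only
      rcases hcases v hv with hv | ⟨i, hi1, hi2, rfl⟩
      · rw [hφ _ (h.par_mem v hv), hφ _ hv]; exact h.adj v hv hvr
      · obtain ⟨i, rfl⟩ : ∃ j, i = j + 1 := ⟨i - 1, by omega⟩
        rw [hcpar i (by omega), hcφ i (by omega), hcφ _ hi2]
        exact y3 i (by omega)
    · intro v hv
      rcases mem_union.1 hv with hv | hv
      · exact h.notMem v hv
      · obtain ⟨i, hi, rfl⟩ := mem_image.1 hv
        exact fun h => y4 i hi (mem_union_left _ h)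
    · intro v hv
      simp only
      rcases hcases v hv with hv | ⟨i, hi1, hi2, rfl⟩
      · rw [hφ v hv]
        exact (h.cover v hv).imp_left fun h => mem_union_left _ h
      · rw [hcφ i hi2]
        rcases Nat.lt_or_ge (2 * a) i with h1 | h1
        · have : i = 2 * a + 1 := by omega
          subst this
          refine Or.inr (Or.inl ⟨hbR.1, ?_⟩)
          simpa [hc] using hqP
        · exact Or.inl (mem_union_right _ (mem_image_of_mem _ (mem_Icc.2 ⟨hi1, h1⟩)))
    · intro v hv
      simp only
      rcases mem_union.1 hv with hv | hv
      · obtain ⟨v', hv', rfl⟩ := h.exists_eq v hv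
        exact ⟨v', mem_union_left _ hv', hφ v' hv'⟩
      · obtain ⟨i, hi, rfl⟩ := mem_image.1 hv
        rw [mem_Icc] at hi
        exact ⟨c i, hcE' i (by omega), hcφ i (by omega)⟩
    · intro v hv hvA
      simp only at hvA ⊢
      rcases hcases v hv with hv | ⟨i, hi1, hi2, rfl⟩
      · rw [hφ v hv] at hvA ⊢
        have hvA' : s.φ v ∈ s.A := by
          rcases mem_union.1 hvA with h1 | h1
          · exact h1
          · obtain ⟨i, hi, hi2⟩ := mem_image.1 h1
            rw [mem_Icc] at hi
            exact absurd hi2.symm (hyE i hi.1 (by omega) v hv)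
        obtain ⟨w', hw', h1, h2⟩ := h.charge v hv hvA'
        exact ⟨w', mem_union_left _ hw', by rw [y6 _ hvA', h1, hφ _ hw'], h2⟩
      · have hi3 : i ≤ 2 * a := by
          by_contra hi3
          have : i = 2 * a + 1 := by omega
          subst this
          rw [hcφ _ hi2] at hvA
          rcases mem_union.1 hvA with h1 | h1
          · exact h.notMem _ h1 (hR hbR.1)
          · obtain ⟨j, hj, hj2⟩ := mem_image.1 h1
            exact y4 j hj (mem_union_left _ (hj2 ▸ hR hbR.1))
        obtain ⟨i, rfl⟩ : ∃ j, i = j + 1 := ⟨i - 1, by omega⟩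
        rw [hcφ _ hi2]
        rcases y7 (i + 1) (mem_Icc.2 ⟨hi1, hi3⟩) with h1 | h1
        · refine ⟨c i, hcE' i (by omega), ?_, Or.inl (hcpar i (by omega)).symm⟩
          rw [h1, hcφ i (by omega)]; rfl
        · refine ⟨c (i + 2), hcE' _ (by omega), ?_, Or.inr ⟨hcpar (i + 1) (by omega),
            hcr _ (by omega) (by omega)⟩⟩
          rw [h1, hcφ (i + 2) (by omega)]
    · exact y8
  · have hun : uncovered R ⟨E', φ', A', g'⟩ = (s.uncovered R).erase (y (2 * a + 1)) := by
      ext b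
      simp only [uncovered, mem_sdiff, mem_erase, himage, mem_union, mem_image, mem_Icc]
      constructor
      · rintro ⟨h1, h2⟩
        refine ⟨?_, h1, fun h3 => h2 (Or.inl h3)⟩
        rintro rfl
        exact h2 (Or.inr ⟨2 * a + 1, ⟨by omega, le_rfl⟩, rfl⟩)
      · rintro ⟨h1, h2, h3⟩
        refine ⟨h2, ?_⟩
        rintro (h4 | ⟨i, hi, rfl⟩)
        · exact h3 h4
        · have hi3 : i ≤ 2 * a := by
            by_contra hi3
            have : i = 2 * a + 1 := by omega
            exact h1 (by rw [this])
          exact hyO i hi.1 hi3 (mem_union_left _ (hR h2))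
    rw [hun, card_erase_of_mem y2]
    have := card_pos.2 ⟨_, y2⟩
    omega

end PartialEmbedding
-- Dividing the tree among the phases.
namespace RootedTree

variable {W : Type*} [Fintype W] [DecidableEq W] (T : RootedTree W) {Δ : ℕ}

lemma card_iterate_par_fiber_le (hΔ : ∀ w, #{v | v ≠ T.root ∧ T.par v = w} ≤ Δ) (z : W) (h : ℕ) :
    #{q | h ≤ T.dep q ∧ T.par^[h] q = z} ≤ Δ ^ h := by
  induction h with
  | zero =>
    have : ({q | 0 ≤ T.dep q ∧ T.par^[0] q = z} : Finset W) = {z} := by ext; simp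
    rw [this]; simp
  | succ h ih =>
    have h1 : ({q | h + 1 ≤ T.dep q ∧ T.par^[h + 1] q = z} : Finset W) ⊆
        Finset.biUnion {q | h ≤ T.dep q ∧ T.par^[h] q = z}
          fun c => {v | v ≠ T.root ∧ T.par v = c} := by
      intro q hq
      simp only [mem_filter, mem_univ, true_and, mem_biUnion] at hq ⊢
      have hqr := T.ne_root_of_dep_pos (w := q) (by omega)
      have := T.dep_par q hqr
      exact ⟨T.par q, ⟨by omega, hq.2⟩, hqr, rfl⟩
    refine (card_le_card h1).trans ((card_biUnion_le_card_mul _ _ _ fun c _ => hΔ c).trans ?_)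
    rw [pow_succ]; gcongr

lemma card_shallow_le (hΔ : ∀ w, #{v | v ≠ T.root ∧ T.par v = w} ≤ Δ) (hΔ0 : 0 < Δ) (v : W)
    (h : ℕ) : #{q | v ∈ T.anc q ∧ T.dep q < T.dep v + h} ≤ h * Δ ^ h := by
  have h1 : ({q | v ∈ T.anc q ∧ T.dep q < T.dep v + h} : Finset W) ⊆
      (range h).biUnion fun i => {q | i ≤ T.dep q ∧ T.par^[i] q = v} := by
    intro q hq
    simp only [mem_filter, mem_univ, true_and, mem_biUnion, mem_range] at hq ⊢
    obtain ⟨i, hi, rfl⟩ := T.mem_anc.1 hq.1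
    have := T.dep_iterate hi
    exact ⟨i, by omega, hi, rfl⟩
  refine (card_le_card h1).trans ((card_biUnion_le_card_mul _ _ (Δ ^ h) ?_).trans ?_)
  · intro i hi
    exact (T.card_iterate_par_fiber_le hΔ v i).trans
      (Nat.pow_le_pow_right hΔ0 (mem_range.1 hi).le)
  · rw [card_range]

/-- The number of elements of `P` below `v`. -/
def weight (P : Finset W) (v : W) : ℕ := #{q ∈ P | v ∈ T.anc q}

/-- A descendant carrying a constant proportion, but at most half, of the weight below `v`. -/
lemma exists_descendant (hΔ : ∀ w, #{v | v ≠ T.root ∧ T.par v = w} ≤ Δ) (P : Finset W) (v : W)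
    (hv : 4 ≤ T.weight P v) : ∃ u, v ∈ T.anc u ∧ 2 * T.weight P u ≤ T.weight P v ∧
      T.weight P v ≤ 4 * Δ * T.weight P u := by
  -- Take a deepest `x` below `v` carrying more than half of the weight. All its children carry at
  -- most half, and some child is heavy enough: the children together carry the weight of `x`, up to
  -- one for `x` itself.
  obtain ⟨x, hx, hmax⟩ := exists_max_image
    ({x | v ∈ T.anc x ∧ T.weight P v < 2 * T.weight P x} : Finset W) T.dep
    ⟨v, by simp [T.self_mem_anc]; omega⟩
  simp only [mem_filter, mem_univ, true_and] at hx hmax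
  set C : Finset W := {c | c ≠ T.root ∧ T.par c = x} with hC
  have hxc : ∀ c ∈ C, x ∈ T.anc c ∧ T.dep c = T.dep x + 1 := by
    intro c hc
    simp only [hC, mem_filter, mem_univ, true_and] at hc
    rw [T.anc_eq_insert hc.1, T.dep_par c hc.1, hc.2]
    exact ⟨mem_insert_of_mem (T.self_mem_anc _), rfl⟩
  have hlight : ∀ c ∈ C, 2 * T.weight P c ≤ T.weight P v := by
    intro c hc
    by_contra! hcon
    have := hmax c ⟨T.anc_trans hx.1 (hxc c hc).1, hcon⟩
    have := (hxc c hc).2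
    omega
  by_contra! hcon
  have hsmall : ∀ c ∈ C, 4 * Δ * T.weight P c ≤ T.weight P v - 1 := by
    intro c hc
    have := hcon c (T.anc_trans hx.1 (hxc c hc).1) (hlight c hc)
    omega
  have hsub : {q ∈ P | x ∈ T.anc q} ⊆ insert x (C.biUnion fun c => {q ∈ P | c ∈ T.anc q}) := by
    intro q hq
    simp only [mem_filter, mem_insert, mem_biUnion] at hq ⊢
    obtain ⟨i, hi, hiq⟩ := T.mem_anc.1 hq.2
    rcases i with _ | i
    · exact Or.inl hiq
    · right
      have := T.dep_iterate (w := q) (i := i) (by omega)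
      refine ⟨T.par^[i] q, ?_, hq.1, T.mem_anc.2 ⟨i, by omega, rfl⟩⟩
      simp only [hC, mem_filter, mem_univ, true_and]
      rw [Function.iterate_succ_apply'] at hiq
      exact ⟨T.ne_root_of_dep_pos (by omega), hiq⟩
  have h1 : T.weight P x ≤ (∑ c ∈ C, T.weight P c) + 1 :=
    (card_le_card hsub).trans ((card_insert_le _ _).trans (by gcongr; exact card_biUnion_le))
  have h2 : ∑ c ∈ C, 4 * Δ * T.weight P c ≤ #C * (T.weight P v - 1) := by
    rw [← smul_eq_mul]; exact sum_le_card_nsmul _ _ _ hsmall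
  rw [← mul_sum] at h2
  have h3 : #C * (T.weight P v - 1) ≤ Δ * (T.weight P v - 1) := by gcongr; exact hΔ x
  rcases Nat.eq_zero_or_pos Δ with h0 | h0
  · have : C = ∅ := by
      rw [← card_eq_zero]; have := hΔ x; rw [← hC] at this; omega
    rw [this, sum_empty] at h1
    omega
  · have h4 : 4 * (∑ c ∈ C, T.weight P c) ≤ T.weight P v - 1 := by
      refine Nat.le_of_mul_le_mul_left ?_ h0
      calc _ = 4 * Δ * ∑ c ∈ C, T.weight P c := by ring
        _ ≤ _ := h2.trans h3
    omega

/-- Many vertices of `P` whose upward paths of length `h` are disjoint. -/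
lemma exists_spread (hΔ : ∀ w, #{v | v ≠ T.root ∧ T.par v = w} ≤ Δ) (P : Finset W) (h : ℕ)
    (hP : ∀ q ∈ P, h ≤ T.dep q) :
    ∃ Q ⊆ P, (∀ q ∈ Q, ∀ q' ∈ Q, T.dep q < T.dep q' → T.dep q + (h + 1) ≤ T.dep q') ∧
      (∀ q ∈ Q, ∀ q' ∈ Q, T.par^[h] q = T.par^[h] q' → q = q') ∧
      #P ≤ (h + 1) * Δ ^ h * #Q := by
  -- Restricting to one residue class of depths costs a factor `h + 1` and separates distinct
  -- levels; then keeping one vertex per ancestor at height `h` costs at most `Δ ^ h`.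
  obtain ⟨ρ, hρ, hcard⟩ : ∃ ρ ∈ range (h + 1),
      #P ≤ (h + 1) * #{q ∈ P | T.dep q % (h + 1) = ρ} := by
    apply exists_le_of_sum_le (by simp)
    rw [← mul_sum, ← card_eq_sum_card_fiberwise
      (fun q _ => by simpa using Nat.mod_lt (T.dep q) h.succ_pos)]
    simp
  set S := {q ∈ P | T.dep q % (h + 1) = ρ} with hS
  obtain ⟨Q, hQ, hinj, himg⟩ := exists_subset_injOn_image_eq_of_surjOn (f := T.par^[h]) S
    (S.image T.par^[h]) (by intro x hx; simpa using hx)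
  have hQS : Q ⊆ S := by exact_mod_cast hQ
  refine ⟨Q, hQS.trans (filter_subset _ _), ?_, fun q hq q' hq' => hinj hq hq', ?_⟩
  · intro q hq q' hq' hlt
    have h1 := (mem_filter.1 (hQS hq)).2
    have h2 := (mem_filter.1 (hQS hq')).2
    have h3 := Nat.div_add_mod (T.dep q) (h + 1)
    have h4 := Nat.div_add_mod (T.dep q') (h + 1)
    have h5 : T.dep q / (h + 1) < T.dep q' / (h + 1) := by
      by_contra! hle
      have := Nat.mul_le_mul_left (h + 1) hle
      omega
    have h6 := Nat.mul_le_mul_left (h + 1) (Nat.succ_le_of_lt h5)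
    rw [Nat.mul_succ] at h6
    omega
  · have h1 : #S ≤ Δ ^ h * #(S.image T.par^[h]) := by
      refine card_le_mul_card_image S _ fun z _ => ?_
      refine (card_le_card ?_).trans (T.card_iterate_par_fiber_le hΔ z h)
      intro q hq
      obtain ⟨hq1, hq2⟩ := mem_filter.1 hq
      exact mem_filter.2 ⟨mem_univ _, hP q (mem_filter.1 hq1).1, hq2⟩
    rw [← himg, card_image_of_injOn hinj] at h1
    calc #P ≤ (h + 1) * #S := hcard
      _ ≤ (h + 1) * (Δ ^ h * #Q) := by gcongr
      _ = _ := by ring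

end RootedTree

/-! ### Covering the reservoir `R` in phases. -/

namespace PartialEmbedding

variable {V W : Type*} [Fintype V] [DecidableEq V] [Fintype W] [DecidableEq W]
variable {T : RootedTree W} {G : SimpleGraph V} [DecidableRel G.Adj] {O R : Finset V} {x₀ : V}
  {P : Finset W} {D M m K Δ : ℕ} {s : PartialEmbedding V W}

/-- Process the vertices of `Q` one after the other, embedding each into an uncovered vertex of `R`
whenever there is a link. -/
lemma Valid.exists_cover (h : s.Valid T G O R x₀ P D (2 * m)) (hR : R ⊆ O) (hx : x₀ ∈ O)
    (hΔ : ∀ w, #{v | v ≠ T.root ∧ T.par v = w} ≤ Δ) (hK : 2 ≤ K) (hD : Δ + 1 + K ≤ D)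
    (hJ : Joined G m) (hm : 0 < m) {a k : ℕ} {Q : Finset W} (hQP : Q ⊆ P)
    (hQdep : ∀ q ∈ Q, 2 * a + 1 ≤ T.dep q)
    (hQnew : ∀ q ∈ Q, ∀ i ≤ 2 * a, T.par^[i] q ∉ s.E)
    (hQlevel : ∀ q ∈ Q, ∀ q' ∈ Q, T.dep q < T.dep q' → T.dep q + (2 * a + 1 + 1) ≤ T.dep q')
    (hQinj : ∀ q ∈ Q, ∀ q' ∈ Q, T.par^[2 * a + 1] q = T.par^[2 * a + 1] q' → q = q')
    (hk : m ≤ k * K ^ a) (hQk : k + #(s.uncovered R) ≤ #Q)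
    (hcap : #O + Fintype.card W + 4 * (k * K ^ a) + m + 2 * m * D < Fintype.card V) :
    ∃ t : PartialEmbedding V W, t.Valid T G O R x₀ P D (2 * m) ∧ s.Extends t ∧
      t.E = s.E ∪ Q.biUnion T.anc ∧ #(t.uncovered R) < k := by
  have hcap' : #O + Fintype.card W + m + 2 * m * D < Fintype.card V := by omega
  have hD' : Δ + 1 < D := by omega
  -- `F` collects the starting points at which no link was found. Every processed vertex either adds
  -- to `F` or covers one vertex of `R`, which is the displayed count.
  have key : ∀ Q' : Finset W, Q' ⊆ Q → ∃ (t : PartialEmbedding V W) (F : Finset W),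
      t.Valid T G O R x₀ P D (2 * m) ∧ s.Extends t ∧ t.E = s.E ∪ Q'.biUnion T.anc ∧
      #F + #(s.uncovered R) = #Q' + #(t.uncovered R) ∧ F ⊆ t.E ∧
      (∀ z ∈ F, ∃ q ∈ Q', T.par^[2 * a + 1] q = z) ∧
      ∀ z ∈ F, ∀ y g', ¬ IsLink G O D (2 * m) t.A t.g (t.uncovered R) a (t.φ z) y g' := by
    intro Q'
    -- Processing by increasing depth guarantees that the path above the current `q` has not been
    -- embedded on behalf of an earlier vertex.
    induction Q' using Finset.induction_on_max_value T.dep with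
    | empty => exact fun _ => ⟨s, ∅, h, .refl s, by simp, by simp, by simp, by simp, by simp⟩
    | insert q Q' hq hmax ih =>
      intro hsub
      obtain ⟨t, F, h1, h2, h3, h4, h5, h6, h7⟩ := ih ((subset_insert _ _).trans hsub)
      have hqQ : q ∈ Q := hsub (mem_insert_self _ _)
      have hQ' : ∀ q' ∈ Q', q' ∈ Q := fun q' hq' => hsub (mem_insert_of_mem hq')
      have hqd := hQdep q hqQ
      set z := T.par^[2 * a + 1] q with hz
      have hdz : T.dep z + (2 * a + 1) = T.dep q := T.dep_iterate hqd
      have hzq : z ∈ T.anc q := T.mem_anc.2 ⟨_, hqd, rfl⟩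
      obtain ⟨t₁, i1, i2, i3, i4⟩ := h1.extend_anc hR hx hΔ hD' hJ hm hcap' z
      have hzt : z ∈ t₁.E := by rw [i3]; exact mem_union_right _ (T.self_mem_anc z)
      have hnew : ∀ i ≤ 2 * a, T.par^[i] q ∉ t₁.E := by
        intro i hi hmem
        have hdi := T.dep_iterate (w := q) (i := i) (by omega)
        rw [i3, h3] at hmem
        rcases mem_union.1 hmem with hmem | hmem
        · rcases mem_union.1 hmem with hmem | hmem
          · exact hQnew q hqQ i hi hmem
          · obtain ⟨q', hq', hmem⟩ := mem_biUnion.1 hmem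
            have hle := T.dep_le_of_mem_anc hmem
            rcases (hmax q' hq').lt_or_eq with hlt | heq
            · have := hQlevel q' (hQ' q' hq') q hqQ hlt
              omega
            · have hit := T.iterate_of_mem_anc hmem
              have e : T.dep q' - T.dep (T.par^[i] q) = i := by omega
              rw [e] at hit
              have : T.par^[2 * a + 1] q' = T.par^[2 * a + 1] q := by
                have e2 : 2 * a + 1 = (2 * a + 1 - i) + i := by omega
                rw [e2, Function.iterate_add_apply, hit, ← Function.iterate_add_apply]
              have := hQinj q' (hQ' q' hq') q hqQ this
              exact hq (this ▸ hq')
        · have := T.dep_le_of_mem_anc hmem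
          omega
      have hE : ∀ t₂ : PartialEmbedding V W, t₂.E = t₁.E ∪ T.anc q →
          t₂.E = s.E ∪ (insert q Q').biUnion T.anc := by
        intro t₂ ht₂
        rw [ht₂, i3, h3, biUnion_insert]
        ext w
        have : w ∈ T.anc z → w ∈ T.anc q := fun hw => T.anc_trans hw hzq
        simp only [mem_union]
        tauto
      have hspec : ∀ t' : PartialEmbedding V W, t'.Valid T G O R x₀ P D (2 * m) →
          ∀ u ∈ t'.A, u ∉ O ∧ G.Adj (t'.g u) u := by
        intro t' ht' u hu
        obtain ⟨w, _, _, hw⟩ := ht'.g_spec hx hu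
        exact ⟨ht'.notMem u hu, hw⟩
      -- A failure is permanent: a link available later would, by roll-back, have been available
      -- earlier.
      have hanti : ∀ t' t'' : PartialEmbedding V W, t''.Valid T G O R x₀ P D (2 * m) →
          t'.Extends t'' → ∀ ζ ∈ t'.E,
          (∀ y g', ¬ IsLink G O D (2 * m) t'.A t'.g (t'.uncovered R) a (t'.φ ζ) y g') →
          ∀ y g', ¬ IsLink G O D (2 * m) t''.A t''.g (t''.uncovered R) a (t''.φ ζ) y g' := by
        intro t' t'' hv hext ζ hζ hno y g' hlink
        rw [hext.φ_eq ζ hζ] at hlink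
        exact hno y g' (hlink.anti hext.A_subset hext.uncovered_subset
          hext.g_eq (hspec t'' hv))
      by_cases hlink : ∃ y g', IsLink G O D (2 * m) t₁.A t₁.g (t₁.uncovered R) a (t₁.φ z) y g'
      · obtain ⟨y, g', hlink⟩ := hlink
        obtain ⟨t₂, j1, j2, j3, j4⟩ := i1.extend_link hR hx hqd (hQP hqQ) hzt hnew hlink
        have hext := i2.trans j2
        refine ⟨t₂, F, j1, h2.trans hext, hE t₂ j3, ?_, h5.trans hext.E_subset, ?_, ?_⟩
        · rw [card_insert_of_notMem hq]; rw [i4] at j4; omega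
        · intro ζ hζ
          obtain ⟨q', hq', h⟩ := h6 ζ hζ
          exact ⟨q', mem_insert_of_mem hq', h⟩
        · intro ζ hζ
          exact hanti t t₂ j1 hext ζ (h5 hζ) (h7 ζ hζ)
      · push Not at hlink
        obtain ⟨t₂, j1, j2, j3, j4⟩ := i1.extend_anc hR hx hΔ hD' hJ hm hcap' q
        have hext := i2.trans j2
        have hzF : z ∉ F := by
          intro hzF
          obtain ⟨q', hq', h⟩ := h6 z hzF
          have := hQinj q' (hQ' q' hq') q hqQ h
          exact hq (this ▸ hq')
        refine ⟨t₂, insert z F, j1, h2.trans hext, hE t₂ j3, ?_, ?_, ?_, ?_⟩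
        · rw [card_insert_of_notMem hq, card_insert_of_notMem hzF, j4, i4]; omega
        · exact insert_subset (j2.E_subset hzt) (h5.trans hext.E_subset)
        · intro ζ hζ
          rcases mem_insert.1 hζ with rfl | hζ
          · exact ⟨q, mem_insert_self _ _, rfl⟩
          · obtain ⟨q', hq', h⟩ := h6 ζ hζ
            exact ⟨q', mem_insert_of_mem hq', h⟩
        · intro ζ hζ
          rcases mem_insert.1 hζ with rfl | hζ
          · exact hanti t₁ t₂ j1 j2 _ hzt hlink
          · exact hanti t t₂ j1 hext ζ (h5 hζ) (h7 ζ hζ)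
  obtain ⟨t, F, h1, h2, h3, h4, h5, h6, h7⟩ := key Q Subset.rfl
  refine ⟨t, h1, h2, h3, ?_⟩
  -- If `k` vertices stay uncovered, the count gives at least `k` failures. Uncovered vertices carry
  -- no charges, so `Ext.exists_link` yields a link at one of the failures, which is impossible.
  by_contra! hbk
  have hcard := h1.card_le
  have hFc : #(F.image t.φ) = #F := card_image_of_injOn (h1.inj.mono h5)
  obtain ⟨x, hxF, y, g', hlink⟩ := h1.ext.exists_link hJ hm hK (by omega) (a := a) (s := k)
    (Z := F.image t.φ) (B := t.uncovered R)
    (by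
      intro v hv
      obtain ⟨w, hw, rfl⟩ := mem_image.1 hv
      exact h1.mem_O hR hx (h5 hw))
    (sdiff_subset.trans hR)
    (by
      rw [disjoint_left]
      intro v hv hv2
      obtain ⟨w, hw, rfl⟩ := mem_image.1 hv
      exact (mem_sdiff.1 hv2).2 (mem_image_of_mem _ (h5 hw)))
    (by
      intro u hu
      obtain ⟨w, hw, hg, hadj⟩ := h1.g_spec hx hu
      exact ⟨h1.notMem u hu, by rw [hg]; exact h1.mem_O hR hx hw, hadj⟩)
    (by
      intro v hv
      obtain ⟨w, hw, rfl⟩ := mem_image.1 hv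
      have := h1.card_charge_le hx hΔ (h5 hw)
      omega)
    (by
      intro u hu hB
      obtain ⟨w, hw, hg, _⟩ := h1.g_spec hx hu
      rw [hg] at hB
      exact (mem_sdiff.1 hB).2 (mem_image_of_mem _ hw))
    (by omega) hbk hk (by omega)
  obtain ⟨w, hw, rfl⟩ := mem_image.1 hxF
  exact h7 w hw y g' hlink

/-- One phase: most uncovered vertices get covered using the part of the tree below `v` that is not
below a suitable descendant `u` of `v`. -/
lemma Valid.phase (h : s.Valid T G O R x₀ P D (2 * m)) (hR : R ⊆ O) (hx : x₀ ∈ O)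
    (hΔ : ∀ w, #{v | v ≠ T.root ∧ T.par v = w} ≤ Δ) (hΔ0 : 0 < Δ) (hK : 2 ≤ K)
    (hD : Δ + 1 + K ≤ D) (hJ : Joined G m) (hm : 0 < m) {a k : ℕ} {v : W}
    (hv : ∀ x ∈ s.E, v ∈ T.anc x → x = v) (hk : m ≤ k * K ^ a)
    (hweight : 2 * (2 * a + 2) * Δ ^ (2 * a + 1) * (k + #(s.uncovered R)) +
      2 * (2 * a + 1) * Δ ^ (2 * a + 1) ≤ T.weight P v)
    (hcap : #O + Fintype.card W + 4 * (k * K ^ a) + m + 2 * m * D < Fintype.card V) :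
    ∃ (t : PartialEmbedding V W) (u : W), t.Valid T G O R x₀ P D (2 * m) ∧
      (∀ x ∈ t.E, u ∈ T.anc x → x = u) ∧ T.weight P v ≤ 4 * Δ * T.weight P u ∧
      #(t.uncovered R) < k := by
  have hk0 : 0 < k := by
    rcases Nat.eq_zero_or_pos k with rfl | h
    · omega
    · exact h
  have hpow : 0 < Δ ^ (2 * a + 1) := by positivity
  have hw4 : 4 ≤ T.weight P v := by
    refine le_trans ?_ hweight
    have : 4 * 1 * 1 ≤ 2 * (2 * a + 2) * Δ ^ (2 * a + 1) * (k + #(s.uncovered R)) := by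
      gcongr <;> omega
    omega
  obtain ⟨u, hu1, hu2, hu3⟩ := T.exists_descendant hΔ P v hw4
  set P' : Finset W := {q ∈ P | v ∈ T.anc q ∧ T.dep v + (2 * a + 1) ≤ T.dep q ∧ u ∉ T.anc q}
    with hP'
  -- The weight below `u`, at most half, is saved for later phases. Vertices too close to `v` are
  -- few; the rest have their whole path below `v`, where nothing is embedded yet.
  have hPc : T.weight P v ≤ #P' + (T.weight P u + (2 * a + 1) * Δ ^ (2 * a + 1)) := by
    refine le_trans ?_ (Nat.add_le_add_left (Nat.add_le_add_left
      (T.card_shallow_le hΔ hΔ0 v (2 * a + 1)) _) _)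
    refine le_trans (card_le_card ?_) ((card_union_le _ _).trans
      (Nat.add_le_add_left (card_union_le _ _) _))
    intro q hq
    simp only [hP', mem_union, mem_filter, mem_univ, true_and] at hq ⊢
    by_cases h1 : u ∈ T.anc q
    · exact Or.inr (Or.inl ⟨hq.1, h1⟩)
    · by_cases h2 : T.dep v + (2 * a + 1) ≤ T.dep q
      · exact Or.inl ⟨hq.1, hq.2, h2, h1⟩
      · exact Or.inr (Or.inr ⟨hq.2, by omega⟩)
  obtain ⟨Q, hQP, hQ1, hQ2, hQ3⟩ := T.exists_spread hΔ P' (2 * a + 1)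
    (fun q hq => by simp only [hP', mem_filter] at hq; omega)
  have hQk : k + #(s.uncovered R) ≤ #Q := by
    have e1 : 2 * (2 * a + 2) * Δ ^ (2 * a + 1) * (k + #(s.uncovered R)) =
        2 * ((2 * a + 2) * Δ ^ (2 * a + 1) * (k + #(s.uncovered R))) := by ring
    have e2 : 2 * (2 * a + 1) * Δ ^ (2 * a + 1) = 2 * ((2 * a + 1) * Δ ^ (2 * a + 1)) := by ring
    rw [e1, e2] at hweight
    refine le_of_mul_le_mul_left (a := (2 * a + 2) * Δ ^ (2 * a + 1)) ?_ (by positivity)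
    have e3 : (2 * a + 1 + 1) * Δ ^ (2 * a + 1) * #Q = (2 * a + 2) * Δ ^ (2 * a + 1) * #Q := rfl
    omega
  have hQ' : ∀ q ∈ Q, q ∈ P ∧ v ∈ T.anc q ∧ T.dep v + (2 * a + 1) ≤ T.dep q ∧ u ∉ T.anc q :=
    fun q hq => mem_filter.1 (hQP hq)
  obtain ⟨t, h1, h2, h3, h4⟩ := h.exists_cover hR hx hΔ hK hD hJ hm
    (fun q hq => (hQ' q hq).1) (fun q hq => by have := (hQ' q hq).2.2.1; omega)
    (fun q hq i hi hmem => by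
      obtain ⟨_, g1, g2, _⟩ := hQ' q hq
      have hd := T.dep_iterate (w := q) (i := i) (by omega)
      have := hv _ hmem (T.mem_anc_of_dep_le g1 (T.mem_anc.2 ⟨i, by omega, rfl⟩) (by omega))
      rw [this] at hd
      omega) hQ1 hQ2 hk hQk hcap
  -- Embedding down to `u` itself puts `u` in the position of `v` for the next phase.
  obtain ⟨t', i1, i2, i3, i4⟩ := h1.extend_anc hR hx hΔ (by omega) hJ hm (by omega) u
  refine ⟨t', u, i1, ?_, hu3, by rw [i4]; exact h4⟩
  have hanti : ∀ x y, x ∈ T.anc y → y ∈ T.anc x → x = y := by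
    intro x y hxy hyx
    have e1 := T.dep_le_of_mem_anc hxy
    have e2 := T.dep_le_of_mem_anc hyx
    have e3 := T.iterate_of_mem_anc hxy
    have e4 : T.dep y - T.dep x = 0 := by omega
    rw [e4] at e3
    exact e3.symm
  intro x hxE hux
  rw [i3, h3] at hxE
  rcases mem_union.1 hxE with hxE | hxE
  · rcases mem_union.1 hxE with hxE | hxE
    · have hxv := hv x hxE (T.anc_trans hu1 hux)
      subst hxv
      exact hanti x u hu1 hux
    · obtain ⟨q, hq, hxq⟩ := mem_biUnion.1 hxE
      exact absurd (T.anc_trans hux hxq) (hQ' q hq).2.2.2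
  · exact hanti x u hxE hux

end PartialEmbedding

open PartialEmbedding in
/-- Embed a tree so that every vertex of `R` is the image of a vertex of `P`, avoiding `U`. -/
theorem RootedTree.exists_embedding {V W : Type*} [Fintype V] [DecidableEq V] [Fintype W]
    [DecidableEq W] (T : RootedTree W) (G : SimpleGraph V) [DecidableRel G.Adj]
    {U R : Finset V} {x₀ : V} {P : Finset W} {D m K Δ : ℕ} (hΔ0 : 0 < Δ)
    (hΔ : ∀ w, #{v | v ≠ T.root ∧ T.par v = w} ≤ Δ) (hKΔ : K = 8 * Δ ^ 3) (hD : Δ + 1 + K ≤ D)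
    (hJ : Joined G m) (hm : 0 < m) (hUR : Disjoint U R) (hx₀ : x₀ ∉ U ∪ R)
    (hexp : ∀ X : Finset V, #X ≤ 2 * m → (D + 1) * #X ≤ #(nbhd G X \ (U ∪ R)))
    (hP : 128 * Δ ^ 4 * m + 4 * Δ * #R ≤ #P)
    (hcap : #U + #R + 1 + Fintype.card W + 4 * (K + 1) * m + m + 2 * m * D < Fintype.card V) :
    ∃ φ : W → V, Function.Injective φ ∧ (∀ w, w ≠ T.root → G.Adj (φ (T.par w)) (φ w)) ∧
      (∀ w, φ w ∉ U) ∧ ∀ b ∈ R, ∃ w ∈ P, φ w = b := by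
  set O : Finset V := insert x₀ (U ∪ R) with hO
  have hRO : R ⊆ O := subset_union_right.trans (subset_insert _ _)
  have hxO : x₀ ∈ O := mem_insert_self _ _
  have hOc : #O = #U + #R + 1 := by
    rw [hO, card_insert_of_notMem hx₀, card_union_of_disjoint hUR]
  have hK : 2 ≤ K := by
    have : 1 ≤ Δ ^ 3 := Nat.one_le_pow _ _ hΔ0
    omega
  have hKm : 4 * (K + 1) * m = 4 * (K * m) + 4 * m := by ring
  have hcap0 : #O + Fintype.card W + m + 2 * m * D < Fintype.card V := by omega
  set s₀ : PartialEmbedding V W := ⟨{T.root}, fun _ => x₀, ∅, id⟩ with hs₀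
  have hv₀ : s₀.Valid T G O R x₀ P D (2 * m) := by
    constructor
    · simp [hs₀]
    · rfl
    · simp [hs₀, T.par_root]
    · simp [hs₀]
    · simp [hs₀]
    · simp [hs₀]
    · simp [hs₀]
    · simp [hs₀]
    · simp [hs₀]
    -- The `D + 1` in `hexp` pays for the additional occupied vertex `x₀`.
    · intro X hX
      simp only [hs₀, union_empty]
      rcases X.eq_empty_or_nonempty with rfl | hne
      · simp
      have h1 := hexp X hX
      have h2 : nbhd G X \ (U ∪ R) ⊆ insert x₀ (nbhd G X \ O) := by
        intro u hu
        simp only [hO, mem_sdiff, mem_insert] at hu ⊢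
        tauto
      have h3 := (card_le_card h2).trans (card_insert_le _ _)
      have h4 := card_pos.2 hne
      rw [add_mul] at h1
      omega
  have hu₀ : #(s₀.uncovered R) ≤ #R := card_le_card sdiff_subset
  have hw₀ : T.weight P T.root = #P := by
    unfold RootedTree.weight
    rw [filter_true_of_mem]
    intro q _; exact T.root_mem_anc q
  -- Phase `i` uses links of length `2 * i + 1`. It ends with fewer than `m / K ^ i` uncovered
  -- vertices and with a `(4 * Δ) ^ (i + 1)`-th part of `P` still in reserve below `v`.
  have hphases : ∀ i : ℕ, ∃ t : PartialEmbedding V W, t.Valid T G O R x₀ P D (2 * m) ∧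
      (t.uncovered R = ∅ ∨ ∃ v, (∀ x ∈ t.E, v ∈ T.anc x → x = v) ∧
        #P ≤ (4 * Δ) ^ (i + 1) * T.weight P v ∧ #(t.uncovered R) * K ^ i < m) := by
    intro i
    induction i with
    | zero =>
      obtain ⟨t, u, h1, h2, h3, h4⟩ := hv₀.phase hRO hxO hΔ hΔ0 hK hD hJ hm (a := 0) (k := m)
        (v := T.root) (by simp [hs₀]) (by simp)
        (by
          rw [hw₀]
          refine le_trans ?_ hP
          have e1 : 4 * Δ * #(s₀.uncovered R) ≤ 4 * Δ * #R := by gcongr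
          have e2 : Δ * m ≤ Δ ^ 4 * m := by
            gcongr; exact Nat.le_self_pow (by norm_num) Δ
          have e3 : Δ ≤ Δ * m := Nat.le_mul_of_pos_right _ hm
          simp only [mul_zero, zero_add, pow_one]
          nlinarith)
        (by simp only [pow_zero, mul_one]; omega)
      exact ⟨t, h1, Or.inr ⟨u, h2, by rw [← hw₀]; simpa using h3, by simpa using h4⟩⟩
    | succ i ih =>
      obtain ⟨t, h1, h2⟩ := ih
      rcases h2 with h2 | ⟨v, hv, hw, hb⟩
      · exact ⟨t, h1, Or.inl h2⟩
      by_cases hemp : t.uncovered R = ∅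
      · exact ⟨t, h1, Or.inl hemp⟩
      have hb1 : 1 ≤ #(t.uncovered R) := card_pos.2 (nonempty_iff_ne_empty.2 hemp)
      set b := #(t.uncovered R) with hbdef
      have hq0 : 0 < K ^ i := by positivity
      have hqm : K ^ i < m := lt_of_le_of_lt (Nat.le_mul_of_pos_left _ hb1) hb
      -- This is `m / K ^ (i + 1)` rounded up, the least `k` for which forests of depth `i + 1` have
      -- at least `m` end vertices.
      set k := (m - 1) / K ^ (i + 1) + 1 with hk
      have hkm : (k - 1) * K ^ (i + 1) ≤ m - 1 := Nat.div_mul_le_self _ _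
      have hkm2 : m ≤ k * K ^ (i + 1) := by
        have := Nat.lt_div_mul_add (a := m - 1) (b := K ^ (i + 1)) (by positivity)
        rw [hk, add_mul, one_mul]; omega
      have hk1 : k * K ^ (i + 1) ≤ m + K * m := by
        have e1 : k * K ^ (i + 1) = (k - 1) * K ^ (i + 1) + K * K ^ i := by
          rw [hk, Nat.add_sub_cancel, add_mul, pow_succ]; ring
        have e2 : K * K ^ i ≤ K * m := by gcongr
        omega
      have hk2 : k * K ^ i ≤ 2 * m := by
        have e1 : (k - 1) * K ^ i ≤ (k - 1) * K ^ (i + 1) := by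
          gcongr <;> omega
        have e2 : k * K ^ i = (k - 1) * K ^ i + K ^ i := by
          rw [hk, Nat.add_sub_cancel]; ring
        omega
      have hweight : 2 * (2 * (i + 1) + 2) * Δ ^ (2 * (i + 1) + 1) * (k + b) +
          2 * (2 * (i + 1) + 1) * Δ ^ (2 * (i + 1) + 1) ≤ T.weight P v := by
        -- Here `K = 8 * Δ ^ 3` is used. Each further phase costs `4 * Δ` in reserved weight, `Δ ^
        -- 2` for paths longer by two, and `2` for the linear factor `i + 2 ≤ 2 * 2 ^ i`; the
        -- product is `K`.
        refine le_of_mul_le_mul_left (a := (4 * Δ) ^ (i + 1) * K ^ i) ?_ (by positivity)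
        have hi2 : i + 2 ≤ 2 * 2 ^ i := by
          have := Nat.lt_two_pow_self (n := i)
          have := Nat.one_le_two_pow (n := i)
          omega
        calc (4 * Δ) ^ (i + 1) * K ^ i * (2 * (2 * (i + 1) + 2) * Δ ^ (2 * (i + 1) + 1) * (k + b) +
              2 * (2 * (i + 1) + 1) * Δ ^ (2 * (i + 1) + 1))
            ≤ (4 * Δ) ^ (i + 1) * K ^ i * (2 * (2 * (i + 1) + 2) * Δ ^ (2 * (i + 1) + 1) * (k + b) +
              2 * (2 * (i + 1) + 2) * Δ ^ (2 * (i + 1) + 1)) := by gcongr; omega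
          _ = (4 * Δ) ^ (i + 1) * (4 * (i + 2)) * Δ ^ (2 * (i + 1) + 1) *
              (k * K ^ i + b * K ^ i + K ^ i) := by ring
          _ ≤ (4 * Δ) ^ (i + 1) * (4 * (2 * 2 ^ i)) * Δ ^ (2 * (i + 1) + 1) *
              (2 * m + m + m) := by gcongr
          _ = 128 * Δ ^ 4 * m * (4 ^ i * 2 ^ i * (Δ ^ 3) ^ i) := by rw [mul_pow]; ring
          _ = 128 * Δ ^ 4 * m * K ^ i := by rw [hKΔ, ← mul_pow, ← mul_pow]; norm_num
          _ ≤ #P * K ^ i := by gcongr; omega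
          _ ≤ (4 * Δ) ^ (i + 1) * T.weight P v * K ^ i := by gcongr
          _ = _ := by ring
      obtain ⟨t', u, i1, i2, i3, i4⟩ := h1.phase hRO hxO hΔ hΔ0 hK hD hJ hm (a := i + 1) (k := k)
        (v := v) hv hkm2 hweight (by omega)
      refine ⟨t', i1, Or.inr ⟨u, i2, ?_, ?_⟩⟩
      · calc #P ≤ (4 * Δ) ^ (i + 1) * T.weight P v := hw
          _ ≤ (4 * Δ) ^ (i + 1) * (4 * Δ * T.weight P u) := by gcongr
          _ = _ := by ring
      · have : #(t'.uncovered R) * K ^ (i + 1) ≤ (k - 1) * K ^ (i + 1) := by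
          gcongr; omega
        omega
  -- Since `m < K ^ m`, nothing can be uncovered after phase `m`.
  obtain ⟨t, ht, htu⟩ := hphases m
  have hemp : t.uncovered R = ∅ := by
    rcases htu with h | ⟨v, _, _, hb⟩
    · exact h
    · by_contra hne
      have h1 : 1 ≤ #(t.uncovered R) := card_pos.2 (nonempty_iff_ne_empty.2 hne)
      have h2 : m < K ^ m := Nat.lt_pow_self (by omega)
      have h3 : K ^ m ≤ #(t.uncovered R) * K ^ m := Nat.le_mul_of_pos_left _ h1
      omega
  have hfull : ∀ S : Finset W, ∃ t : PartialEmbedding V W, t.Valid T G O R x₀ P D (2 * m) ∧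
      t.uncovered R = ∅ ∧ S ⊆ t.E := by
    intro S
    induction S using Finset.induction_on with
    | empty => exact ⟨t, ht, hemp, by simp⟩
    | insert w S _ ih =>
      obtain ⟨t, h1, h2, h3⟩ := ih
      obtain ⟨t', i1, i2, i3, i4⟩ := h1.extend_anc hRO hxO hΔ (by omega) hJ hm hcap0 w
      refine ⟨t', i1, by rw [i4, h2], insert_subset ?_ (h3.trans i2.E_subset)⟩
      rw [i3]; exact mem_union_right _ (T.self_mem_anc w)
  obtain ⟨t, h1, h2, h3⟩ := hfull univ
  have hall : ∀ w, w ∈ t.E := fun w => h3 (mem_univ w)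
  refine ⟨t.φ, fun w w' hww => h1.inj (hall w) (hall w') hww, fun w hw => h1.adj w (hall w) hw,
    ?_, ?_⟩
  · intro w hwU
    rcases h1.cover w (hall w) with h4 | h4 | rfl
    · exact h1.notMem _ h4 (mem_insert_of_mem (mem_union_left _ hwU))
    · exact disjoint_left.1 hUR hwU h4.1
    · rw [h1.map_root] at hwU
      exact hx₀ (mem_union_left _ hwU)
  · intro b hb
    by_contra! hcon
    have : b ∈ t.uncovered R := by
      simp only [uncovered, mem_sdiff, mem_image, not_exists, not_and]
      refine ⟨hb, fun w hw hwb => hcon w ?_ hwb⟩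
      exact h1.map_mem_R hRO (fun h => hx₀ (mem_union_right _ h)) hw (hwb ▸ hb)
    rw [h2] at this
    simp at this

/-! ### Spectral estimates. -/

open Matrix in
/-- Parseval's identity in the eigenbasis of a real symmetric matrix. -/
lemma sum_dotProduct_eigenvectorBasis {V : Type*} [Fintype V] [DecidableEq V] {A : Matrix V V ℝ}
    (hA : A.IsHermitian) (u v : V → ℝ) :
    ∑ i, (u ⬝ᵥ (hA.eigenvectorBasis i).ofLp) * (v ⬝ᵥ (hA.eigenvectorBasis i).ofLp) = u ⬝ᵥ v := by
  have h := hA.eigenvectorBasis.sum_inner_mul_inner (WithLp.toLp 2 u) (WithLp.toLp 2 v)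
  simp only [EuclideanSpace.inner_eq_star_dotProduct, star_trivial] at h
  rw [dotProduct_comm u v, ← h]
  refine sum_congr rfl fun i _ => ?_
  rw [dotProduct_comm u]

open Matrix in
lemma mulVec_dotProduct_eigenvectorBasis {V : Type*} [Fintype V] [DecidableEq V]
    {A : Matrix V V ℝ} (hA : A.IsHermitian) (v : V → ℝ) (i : V) :
    (A *ᵥ v) ⬝ᵥ (hA.eigenvectorBasis i).ofLp =
      hA.eigenvalues i * (v ⬝ᵥ (hA.eigenvectorBasis i).ofLp) := by
  have hs : Aᵀ = A := by simpa using hA.eq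
  rw [dotProduct_comm, dotProduct_mulVec, ← mulVec_transpose, hs, hA.mulVec_eigenvectorBasis,
    smul_dotProduct, dotProduct_comm v]
  simp

open Matrix in
/-- The expander mixing lemma. -/
theorem abs_edges_sub_le {V : Type*} [Fintype V] [DecidableEq V] {G : SimpleGraph V}
    [DecidableRel G.Adj] {n d : ℕ} {lam : ℝ} (hG : G.IsNDLambda n d lam) (hlam : 0 ≤ lam)
    (hd : lam < d) (X Y : Finset V) :
    |(∑ x ∈ X, (#(G.neighborFinset x ∩ Y) : ℝ)) - d * #X * #Y / n| ≤ lam * √(#X * #Y) := by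
  rcases Nat.eq_zero_or_pos n with hn | hn
  · have : IsEmpty V := Fintype.card_eq_zero_iff.1 (hG.card_eq.trans hn)
    have hX : X = ∅ := eq_empty_of_isEmpty X
    simp [hX]
  have hn' : (0 : ℝ) < n := by exact_mod_cast hn
  set hA := G.isHermitian_adjMatrix ℝ
  set b : V → V → ℝ := fun i => (hA.eigenvectorBasis i).ofLp with hb
  have hcard : 0 < Fintype.card V := hG.card_eq ▸ hn
  -- `eigenvalues` is `eigenvalues₀` transported along this bijection, so `i₀` is the index of the
  -- largest eigenvalue.
  set e := Fintype.equivOfCardEq (Fintype.card_fin (Fintype.card V)) with he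
  set i₀ : V := e ⟨0, hcard⟩ with hi₀
  have hev : ∀ i, i ≠ i₀ → |hA.eigenvalues i| ≤ lam := by
    intro i hi
    refine hG.abs_eigenvalue_le _ ?_
    intro h0
    apply hi
    rw [hi₀, ← Equiv.symm_apply_eq]
    exact Fin.ext h0
  set one : V → ℝ := fun _ => 1 with hone
  have hA1 : G.adjMatrix ℝ *ᵥ one = fun _ => (d : ℝ) := by
    ext v
    rw [hone, show (fun _ : V => (1 : ℝ)) = Function.const V 1 from rfl,
      SimpleGraph.adjMatrix_mulVec_const_apply_of_regular hG.regular]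
    simp
  -- The constant vector has eigenvalue `d`. As `lam < d`, no index other than `i₀` has this
  -- eigenvalue, so the constant vector is a multiple of `b i₀`.
  have hc1 : ∀ i, i ≠ i₀ → one ⬝ᵥ b i = 0 := by
    intro i hi
    have h1 := mulVec_dotProduct_eigenvectorBasis hA one i
    rw [hA1, show (fun _ : V => (d : ℝ)) = (d : ℝ) • one by ext; simp [hone],
      smul_dotProduct, smul_eq_mul] at h1
    have h2 : hA.eigenvalues i ≠ d := by
      intro h
      have := hev i hi
      rw [h, abs_of_nonneg (by positivity)] at this
      linarith
    have h3 : (d - hA.eigenvalues i) * (one ⬝ᵥ b i) = 0 := by rw [sub_mul]; linarith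
    rcases mul_eq_zero.1 h3 with h | h
    · exact absurd (sub_eq_zero.1 h).symm h2
    · exact h
  have hsum : ∀ v : V → ℝ, (one ⬝ᵥ b i₀) * (v ⬝ᵥ b i₀) = one ⬝ᵥ v := by
    intro v
    rw [← sum_dotProduct_eigenvectorBasis hA one v, eq_comm]
    exact Fintype.sum_eq_single i₀ fun i hi => by
      have := hc1 i hi
      simp only [hb] at this
      rw [this, zero_mul]
  have hone1 : one ⬝ᵥ one = n := by
    simp [hone, dotProduct, hG.card_eq]
  have hc0 : one ⬝ᵥ b i₀ ≠ 0 := by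
    intro h
    have := hsum one
    rw [h, zero_mul, hone1] at this
    exact hn'.ne this
  set x : V → ℝ := fun v => if v ∈ X then 1 else 0 with hx
  set y : V → ℝ := fun v => if v ∈ Y then 1 else 0 with hy
  have hind : ∀ (S : Finset V) (v : V → ℝ),
      (fun w => if w ∈ S then (1 : ℝ) else 0) ⬝ᵥ v = ∑ w ∈ S, v w := by
    intro S v; simp [dotProduct]
  -- Subtracting the mean makes the indicator of `Y` orthogonal to `b i₀`; only eigenvalues bounded
  -- by `lam` then act on it.
  set y' : V → ℝ := y - (#Y / n : ℝ) • one with hy'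
  have hy0 : y' ⬝ᵥ b i₀ = 0 := by
    have h1 := hsum y'
    have h2 : one ⬝ᵥ y' = 0 := by
      rw [hy', dotProduct_sub, dotProduct_smul, hone1, dotProduct_comm, hy, hind]
      simp [hone]; field_simp; simp
    rw [h2] at h1
    exact (mul_eq_zero.1 h1).resolve_left hc0
  have hAy : x ⬝ᵥ (G.adjMatrix ℝ *ᵥ y') =
      (∑ x ∈ X, (#(G.neighborFinset x ∩ Y) : ℝ)) - d * #X * #Y / n := by
    rw [hy', mulVec_sub, mulVec_smul, dotProduct_sub, dotProduct_smul, hA1, hx, hind, hind]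
    congr 1
    · refine sum_congr rfl fun v _ => ?_
      rw [SimpleGraph.adjMatrix_mulVec_apply]
      simp [hy]
    · simp; ring
  have hxx : x ⬝ᵥ x = #X := by rw [hx, hind]; simp
  have hyy : y' ⬝ᵥ y' ≤ #Y := by
    have h1 : y' ⬝ᵥ y' = #Y - (#Y : ℝ) ^ 2 / n := by
      have e1 : y ⬝ᵥ y = #Y := by rw [hy, hind]; simp
      have e2 : y ⬝ᵥ one = #Y := by rw [hy, hind]; simp [hone]
      rw [hy', sub_dotProduct, dotProduct_sub, dotProduct_sub, smul_dotProduct, dotProduct_smul,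
        smul_dotProduct, dotProduct_smul, hone1, dotProduct_comm one y, e1, e2]
      simp; field_simp; ring
    rw [h1]
    have : (0 : ℝ) ≤ (#Y : ℝ) ^ 2 / n := by positivity
    linarith
  rw [← hAy, ← sum_dotProduct_eigenvectorBasis hA]
  calc |∑ i, (x ⬝ᵥ b i) * ((G.adjMatrix ℝ *ᵥ y') ⬝ᵥ b i)|
      ≤ ∑ i, |(x ⬝ᵥ b i) * ((G.adjMatrix ℝ *ᵥ y') ⬝ᵥ b i)| := abs_sum_le_sum_abs _ _
    _ ≤ ∑ i, lam * (|x ⬝ᵥ b i| * |y' ⬝ᵥ b i|) := by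
        refine sum_le_sum fun i _ => ?_
        have := mulVec_dotProduct_eigenvectorBasis hA y' i
        simp only [hb] at hy0 ⊢
        rw [this, abs_mul, abs_mul]
        by_cases hi : i = i₀
        · rw [hi, hy0]; simp
        · have h1 := hev i hi
          calc _ = |hA.eigenvalues i| * (|x ⬝ᵥ (hA.eigenvectorBasis i).ofLp| *
                |y' ⬝ᵥ (hA.eigenvectorBasis i).ofLp|) := by ring
            _ ≤ _ := by gcongr
    _ = lam * ∑ i, |x ⬝ᵥ b i| * |y' ⬝ᵥ b i| := by rw [mul_sum]
    _ ≤ lam * (√(∑ i, |x ⬝ᵥ b i| ^ 2) * √(∑ i, |y' ⬝ᵥ b i| ^ 2)) := by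
        gcongr; exact Real.sum_mul_le_sqrt_mul_sqrt _ _ _
    _ = lam * (√(x ⬝ᵥ x) * √(y' ⬝ᵥ y')) := by
        rw [← sum_dotProduct_eigenvectorBasis hA x, ← sum_dotProduct_eigenvectorBasis hA y']
        simp only [abs_mul_abs_self, hb, sq]
    _ ≤ lam * (√(#X) * √(#Y)) := by rw [hxx]; gcongr
    _ = _ := by rw [Real.sqrt_mul (by positivity)]

variable {V : Type*} [Fintype V] [DecidableEq V] {G : SimpleGraph V} [DecidableRel G.Adj]
  {n d m : ℕ} {lam : ℝ}

/-- Without an edge the mixing lemma gives `√(#X * #Y) ≤ lam * n / d < m`. -/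
lemma joined_of_isNDLambda (hG : G.IsNDLambda n d lam) (hlam : 0 ≤ lam) (hd : lam < d)
    (hm : lam * n < d * m) : Joined G m := by
  intro X Y hX hY
  by_contra! hno
  have h1 := abs_edges_sub_le hG hlam hd X Y
  have h2 : ∀ x ∈ X, (#(G.neighborFinset x ∩ Y) : ℝ) = 0 := by
    intro x hx
    rw [Nat.cast_eq_zero, card_eq_zero, ← disjoint_iff_inter_eq_empty, disjoint_left]
    intro y hy hyY
    exact hno x hx y hyY (by simpa using hy)
  rw [sum_congr rfl h2, sum_const_zero, zero_sub, abs_neg, abs_of_nonneg (by positivity)] at h1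
  have hm0 : 0 < m := by
    rcases Nat.eq_zero_or_pos m with rfl | h
    · have : (0 : ℝ) ≤ lam * n := by positivity
      simp at hm; linarith
    · exact h
  have hn0 : (0 : ℝ) < n := by
    have h3 : 0 < Fintype.card V := by
      have := card_le_univ X; omega
    rw [hG.card_eq] at h3
    exact_mod_cast h3
  have hms : (m : ℝ) ≤ √(#X * #Y) := by
    apply Real.le_sqrt_of_sq_le
    rw [sq]
    have : (m : ℝ) ≤ #X := by exact_mod_cast hX
    have : (m : ℝ) ≤ #Y := by exact_mod_cast hY
    gcongr
  set r := √((#X : ℝ) * #Y) with hr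
  have hrr : r * r = #X * #Y := Real.mul_self_sqrt (by positivity)
  have hm' : (0 : ℝ) < m := by exact_mod_cast hm0
  have hr0 : 0 < r := by linarith
  rw [div_le_iff₀ hn0, mul_assoc, ← hrr] at h1
  have h4 : (d : ℝ) * r * r ≤ lam * n * r := by linarith
  have h5 := le_of_mul_le_mul_right h4 hr0
  have h6 : (d : ℝ) * m ≤ d * r := by gcongr
  linarith

/-- If every vertex has many neighbours in `S` then small sets expand into `S`. -/
lemma expansion_of_isNDLambda (hG : G.IsNDLambda n d lam) (hlam : 0 ≤ lam) (hd : lam < d)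
    {S : Finset V} {γ : ℝ} (hS : ∀ v, γ * d ≤ #(G.neighborFinset v ∩ S)) {D : ℕ} (hD : 0 < D)
    (hγ : 2 * D * m / n * d + D * lam < γ * d) {X : Finset V} (hX : #X ≤ 2 * m) :
    D * #X ≤ #(nbhd G X ∩ S) := by
  by_contra! hlt
  set Y := nbhd G X ∩ S with hY
  have h1 := (abs_le.1 (abs_edges_sub_le hG hlam hd X Y)).2
  have hX0 : 0 < #X := by
    rcases Nat.eq_zero_or_pos #X with h | h
    · rw [h] at hlt; omega
    · exact h
  have hX0' : (0 : ℝ) < #X := by exact_mod_cast hX0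
  -- All edges from `X` into `S` end in `Y`. If `Y` were small, these would be more edges than the
  -- mixing lemma permits.
  have h2 : ∀ x ∈ X, γ * d ≤ (#(G.neighborFinset x ∩ Y) : ℝ) := by
    intro x hx
    refine (hS x).trans ?_
    have : G.neighborFinset x ∩ S ⊆ G.neighborFinset x ∩ Y := by
      intro u hu
      obtain ⟨hu1, hu2⟩ := mem_inter.1 hu
      exact mem_inter.2 ⟨hu1, mem_inter.2 ⟨mem_nbhd.2 ⟨x, hx, by simpa using hu1⟩, hu2⟩⟩
    exact_mod_cast card_le_card this
  have h3 : (#X : ℝ) * (γ * d) ≤ ∑ x ∈ X, (#(G.neighborFinset x ∩ Y) : ℝ) := by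
    rw [← nsmul_eq_mul]; exact card_nsmul_le_sum _ _ _ h2
  have hYc : (#Y : ℝ) ≤ D * #X := by exact_mod_cast hlt.le
  have hD1 : (1 : ℝ) ≤ D := by exact_mod_cast hD
  have h4 : √((#X : ℝ) * #Y) ≤ D * #X := by
    apply Real.sqrt_le_iff.2 ⟨by positivity, ?_⟩
    calc (#X : ℝ) * #Y ≤ #X * (D * #X) := by gcongr
      _ ≤ D * (#X * (D * #X)) := le_mul_of_one_le_left (by positivity) hD1
      _ = _ := by ring
  have hX2 : (#X : ℝ) ≤ 2 * m := by exact_mod_cast hX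
  have h5 : (d : ℝ) * #X * #Y / n ≤ #X * (2 * D * m / n * d) := by
    calc (d : ℝ) * #X * #Y / n ≤ d * #X * (D * (2 * m)) / n := by
          gcongr; exact hYc.trans (by gcongr)
      _ = _ := by ring
  have h6 : lam * √((#X : ℝ) * #Y) ≤ #X * (D * lam) := by
    calc _ ≤ lam * (D * #X) := by gcongr
      _ = _ := by ring
  have h7 : (#X : ℝ) * (γ * d) ≤ #X * (2 * D * m / n * d + D * lam) := by
    rw [mul_add]; linarith
  have := le_of_mul_le_mul_left h7 hX0'
  linarith

/-! ### The local lemma and fair colourings. -/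

section LocalLemma

variable {V κ : Type*} [Fintype V] [DecidableEq V] [Fintype κ] [DecidableEq κ]

/-- Events depending on disjoint sets of coordinates are independent. -/
lemma card_inter_mul_card {S : Finset V} {A B : Finset (V → κ)}
    (hA : ∀ f g : V → κ, (∀ u ∈ S, f u = g u) → f ∈ A → g ∈ A)
    (hB : ∀ f g : V → κ, (∀ u, u ∉ S → f u = g u) → f ∈ B → g ∈ B) :
    #(A ∩ B) * #(univ : Finset (V → κ)) = #A * #B := by
  rw [← card_product, ← card_product]
  -- Exchanging the coordinates outside `S` is an involution carrying `(A ∩ B) × univ` onto `A × B`.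
  set mix : (V → κ) × (V → κ) → (V → κ) × (V → κ) := fun p =>
    (fun u => if u ∈ S then p.1 u else p.2 u, fun u => if u ∈ S then p.2 u else p.1 u) with hmix
  have hinv : ∀ p, mix (mix p) = p := by
    rintro ⟨f, g⟩
    simp only [hmix, Prod.mk.injEq]
    constructor <;> ext u <;> by_cases hu : u ∈ S <;> simp [hu]
  refine card_nbij' mix mix ?_ ?_ (fun p _ => hinv p) (fun p _ => hinv p)
  · rintro ⟨f, g⟩ hp
    simp only [coe_product, coe_inter, coe_univ, Set.mem_prod, Set.mem_inter_iff, mem_coe,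
      Set.mem_univ, and_true] at hp ⊢
    exact ⟨hA f _ (fun u hu => by simp [hmix, hu]) hp.1,
      hB f _ (fun u hu => by simp [hmix, hu]) hp.2⟩
  · rintro ⟨f, g⟩ hp
    simp only [coe_product, coe_inter, coe_univ, Set.mem_prod, Set.mem_inter_iff, mem_coe,
      Set.mem_univ, and_true] at hp ⊢
    exact ⟨hA f _ (fun u hu => by simp [hmix, hu]) hp.1,
      hB g _ (fun u hu => by simp [hmix, hu]) hp.2⟩

/-- The symmetric Lovász local lemma for uniformly random functions. -/
theorem exists_forall_notMem_bad [Nonempty κ] (N : V → Finset V) (bad : V → Finset (V → κ))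
    (hdep : ∀ v (f g : V → κ), (∀ u ∈ N v, f u = g u) → f ∈ bad v → g ∈ bad v) {p : ℝ}
    (hp0 : 0 ≤ p) (hp : ∀ v, (#(bad v) : ℝ) ≤ p * #(univ : Finset (V → κ))) {s : ℕ}
    (hs : ∀ v, #{u | ¬ Disjoint (N u) (N v)} ≤ s) (hps : 4 * p * s ≤ 1) (hp2 : 2 * p < 1) :
    ∃ f : V → κ, ∀ v, f ∉ bad v := by
  set good : Finset V → Finset (V → κ) := fun S => {f | ∀ u ∈ S, f ∉ bad u} with hgood
  have hgm : ∀ {S T : Finset V}, S ⊆ T → good T ⊆ good S := by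
    intro S T h f hf
    simp only [hgood, mem_filter, mem_univ, true_and] at hf ⊢
    exact fun u hu => hf u (h hu)
  have huniv : 0 < #(univ : Finset (V → κ)) := card_pos.2 univ_nonempty
  have huniv' : (0 : ℝ) < #(univ : Finset (V → κ)) := by exact_mod_cast huniv
  -- Conditioned on avoiding the events of `S`, each event has probability at most `2 * p`.
  have key : ∀ n, ∀ S : Finset V, #S = n → ∀ v,
      (#(bad v ∩ good S) : ℝ) ≤ 2 * p * #(good S) := by
    intro n
    induction n using Nat.strong_induction_on with
    | _ n ih =>
    intro S hS v
    set S₁ := {u ∈ S | ¬ Disjoint (N u) (N v)} with hS₁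
    set S₂ := {u ∈ S | Disjoint (N u) (N v)} with hS₂
    have hS₂S : S₂ ⊆ S := filter_subset _ _
    have hind : (#(bad v ∩ good S₂) : ℝ) ≤ p * #(good S₂) := by
      have h1 : #(bad v ∩ good S₂) * #(univ : Finset (V → κ)) = #(bad v) * #(good S₂) := by
        refine card_inter_mul_card (S := N v) (hdep v) ?_
        intro f g hfg hf
        simp only [hgood, mem_filter, mem_univ, true_and] at hf ⊢
        intro u hu hgu
        refine hf u hu (hdep u g f (fun w hw => (hfg w fun hwv => ?_).symm) hgu)
        exact disjoint_left.1 (mem_filter.1 hu).2 hw hwv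
      have h2 : (#(bad v ∩ good S₂) : ℝ) * #(univ : Finset (V → κ)) = #(bad v) * #(good S₂) := by
        exact_mod_cast h1
      refine le_of_mul_le_mul_right ?_ huniv'
      rw [h2]
      calc (#(bad v) : ℝ) * #(good S₂) ≤ p * #(univ : Finset (V → κ)) * #(good S₂) := by
            gcongr; exact hp v
        _ = _ := by ring
    have hS₁s : (#S₁ : ℝ) ≤ s := by
      refine le_trans ?_ (Nat.cast_le.2 (hs v))
      exact_mod_cast card_le_card (filter_subset_filter _ (subset_univ S))
    -- The at most `s` dependent events each remove at most a `2 * p` share of `good S₂` by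
    -- induction, hence together at most half.
    have hhalf : (#(good S₂) : ℝ) ≤ 2 * #(good S) := by
      by_cases hemp : S₁ = ∅
      · have : S₂ = S := by
          rw [hS₂, filter_eq_self]
          intro u hu
          by_contra h
          have : u ∈ S₁ := mem_filter.2 ⟨hu, h⟩
          simp [hemp] at this
        rw [this]
        have : (0 : ℝ) ≤ #(good S) := by positivity
        linarith
      · have hlt : #S₂ < n := by
          rw [← hS]
          apply card_lt_card
          refine ⟨hS₂S, fun h => hemp ?_⟩
          rw [hS₁, filter_eq_empty_iff]
          intro u hu
          exact not_not.2 (mem_filter.1 (h hu)).2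
        have hsub : good S₂ ⊆ good S ∪ S₁.biUnion fun u => bad u ∩ good S₂ := by
          intro f hf
          by_cases hfS : f ∈ good S
          · exact mem_union_left _ hfS
          · simp only [hgood, mem_filter, mem_univ, true_and, not_forall, not_not] at hfS
            obtain ⟨u, hu, hfu⟩ := hfS
            refine mem_union_right _ (mem_biUnion.2 ⟨u, mem_filter.2 ⟨hu, fun hdis => ?_⟩,
              mem_inter.2 ⟨hfu, hf⟩⟩)
            exact (mem_filter.1 hf).2 u (mem_filter.2 ⟨hu, hdis⟩) hfu
        have h1 : #(good S₂) ≤ #(good S) + ∑ u ∈ S₁, #(bad u ∩ good S₂) :=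
          (card_le_card hsub).trans ((card_union_le _ _).trans (by gcongr; exact card_biUnion_le))
        have h2 : (#(good S₂) : ℝ) ≤ #(good S) + ∑ u ∈ S₁, (#(bad u ∩ good S₂) : ℝ) := by
          exact_mod_cast h1
        have h3 : ∑ u ∈ S₁, (#(bad u ∩ good S₂) : ℝ) ≤ #S₁ * (2 * p * #(good S₂)) := by
          rw [← nsmul_eq_mul]
          exact sum_le_card_nsmul _ _ _ fun u _ => ih _ hlt S₂ rfl u
        have h4 : (#S₁ : ℝ) * (2 * p * #(good S₂)) ≤ s * (2 * p * #(good S₂)) := by gcongr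
        have h5 : (s : ℝ) * (2 * p * #(good S₂)) ≤ 1 / 2 * #(good S₂) := by
          calc _ = (4 * p * s) * (1 / 2 * #(good S₂)) := by ring
            _ ≤ 1 * (1 / 2 * #(good S₂)) := by gcongr
            _ = _ := by ring
        linarith
    calc (#(bad v ∩ good S) : ℝ) ≤ #(bad v ∩ good S₂) := by
          exact_mod_cast card_le_card (inter_subset_inter_left (hgm hS₂S))
      _ ≤ p * #(good S₂) := hind
      _ ≤ p * (2 * #(good S)) := by gcongr
      _ = _ := by ring
  have hpos : ∀ S : Finset V, (0 : ℝ) < #(good S) := by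
    intro S
    induction S using Finset.induction_on with
    | empty =>
      have : good ∅ = univ := by simp [hgood]
      rw [this]; exact huniv'
    | insert v S hv ih =>
      have h1 := key _ S rfl v
      have h2 : good S ⊆ good (insert v S) ∪ (bad v ∩ good S) := by
        intro f hf
        by_cases hfv : f ∈ bad v
        · exact mem_union_right _ (mem_inter.2 ⟨hfv, hf⟩)
        · refine mem_union_left _ ?_
          simp only [hgood, mem_filter, mem_univ, true_and, mem_insert] at hf ⊢
          rintro u (rfl | hu)
          · exact hfv
          · exact hf u hu
      have h3 : (#(good S) : ℝ) ≤ #(good (insert v S)) + #(bad v ∩ good S) := by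
        exact_mod_cast (card_le_card h2).trans (card_union_le _ _)
      nlinarith
  obtain ⟨f, hf⟩ := card_pos.1 (by exact_mod_cast hpos univ : 0 < #(good univ))
  exact ⟨f, fun v => (mem_filter.1 hf).2 v (mem_univ v)⟩

/-- A Chernoff-type bound for the number of functions taking the value `c` rarely on `N`. -/
lemma card_rare_le [Nonempty κ] (N : Finset V) (c : κ) (t : ℕ) :
    (#{f : V → κ | #{u ∈ N | f u = c} ≤ t} : ℝ) ≤
      2 ^ t * (1 - 1 / (2 * Fintype.card κ)) ^ #N * #(univ : Finset (V → κ)) := by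
  set k : ℝ := (Fintype.card κ : ℝ) with hk
  have hk0 : 0 < k := by rw [hk]; exact_mod_cast Fintype.card_pos
  have h1 : ∀ f : V → κ, ∏ u, (if u ∈ N ∧ f u = c then (1 / 2 : ℝ) else 1) =
      (1 / 2) ^ #{u ∈ N | f u = c} := by
    intro f
    rw [prod_ite, prod_const_one, mul_one, prod_const]
    congr 2
    ext u; simp
  -- Markov's inequality is applied to `(1 / 2) ^ #{u ∈ N | f u = c}`, whose sum factorises over the
  -- coordinates.
  have h2 : ∑ f : V → κ, ∏ u, (if u ∈ N ∧ f u = c then (1 / 2 : ℝ) else 1) =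
      (1 - 1 / (2 * k)) ^ #N * #(univ : Finset (V → κ)) := by
    have e1 := (prod_univ_sum (fun _ : V => (univ : Finset κ))
      (fun u j => if u ∈ N ∧ j = c then (1 / 2 : ℝ) else 1)).symm
    rw [Fintype.piFinset_univ] at e1
    rw [e1]
    have e2 : ∀ u : V, ∑ j : κ, (if u ∈ N ∧ j = c then (1 / 2 : ℝ) else 1) =
        (if u ∈ N then (1 - 1 / (2 * k)) else 1) * k := by
      intro u
      by_cases hu : u ∈ N
      · simp only [hu, true_and, if_true]
        rw [← add_sum_erase _ _ (mem_univ c), if_pos rfl,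
          sum_congr rfl (g := fun _ => (1 : ℝ)) (fun j hj => if_neg (ne_of_mem_erase hj))]
        simp only [sum_const, card_erase_of_mem (mem_univ c), card_univ, nsmul_eq_mul, mul_one]
        rw [Nat.cast_sub Fintype.card_pos, ← hk]
        field_simp; simp; ring
      · simp [hu, hk]
    rw [prod_congr rfl fun u _ => e2 u, prod_mul_distrib, prod_ite_mem, univ_inter, prod_const,
      prod_const, card_univ, card_univ, Fintype.card_fun, hk]
    push_cast; rfl
  have h3 : (#{f : V → κ | #{u ∈ N | f u = c} ≤ t} : ℝ) * (1 / 2) ^ t ≤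
      ∑ f : V → κ, ∏ u, (if u ∈ N ∧ f u = c then (1 / 2 : ℝ) else 1) := by
    rw [← nsmul_eq_mul]
    refine (card_nsmul_le_sum _ (fun f : V → κ => ∏ u, (if u ∈ N ∧ f u = c then (1 / 2 : ℝ) else 1))
      _ ?_).trans (sum_le_sum_of_subset_of_nonneg (subset_univ _) ?_)
    · intro f hf
      rw [h1]
      exact pow_le_pow_of_le_one (by norm_num) (by norm_num) (mem_filter.1 hf).2
    · intro f _ _
      rw [h1]; positivity
  rw [h2] at h3
  calc (#{f : V → κ | #{u ∈ N | f u = c} ≤ t} : ℝ)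
      = 2 ^ t * (#{f : V → κ | #{u ∈ N | f u = c} ≤ t} * (1 / 2) ^ t) := by
        rw [mul_comm (_ : ℝ) ((1 / 2 : ℝ) ^ t), ← mul_assoc, ← mul_pow]; norm_num
    _ ≤ 2 ^ t * ((1 - 1 / (2 * k)) ^ #N * #(univ : Finset (V → κ))) := by gcongr
    _ = _ := by ring

end LocalLemma

/-- Vertices of a regular graph of large degree can be coloured with `k` colours such that every
vertex has a fair share of neighbours of each colour. -/
theorem eventually_exists_coloring (k : ℕ) (hk : 0 < k) :
    ∀ᶠ d : ℕ in Filter.atTop, ∀ (V : Type*) [Fintype V] [DecidableEq V] (G : SimpleGraph V)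
      [DecidableRel G.Adj], G.IsRegularOfDegree d →
      ∃ f : V → Fin k, ∀ v c, d ≤ 4 * k * #{u ∈ G.neighborFinset v | f u = c} := by
  have : Nonempty (Fin k) := ⟨⟨0, hk⟩⟩
  have hkR : (1 : ℝ) ≤ k := by exact_mod_cast hk
  set ρ : ℝ := 1 - 1 / (4 * k) with hρ
  have hinv : (1 : ℝ) / (4 * k) ≤ 1 / 4 := by
    apply one_div_le_one_div_of_le <;> linarith
  have hinv0 : (0 : ℝ) < 1 / (4 * k) := by positivity
  have hρ0 : 0 ≤ ρ := by linarith
  have hρ1 : ρ < 1 := by linarith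
  have hlim : Filter.Tendsto (fun d : ℕ => 4 * (k : ℝ) * ((d : ℝ) ^ 2 * ρ ^ d)) Filter.atTop
      (nhds (4 * (k : ℝ) * 0)) :=
    (tendsto_pow_const_mul_const_pow_of_lt_one 2 hρ0 hρ1).const_mul _
  rw [mul_zero] at hlim
  filter_upwards [hlim.eventually_le_const (by norm_num : (0 : ℝ) < 1),
    Filter.eventually_ge_atTop 1] with d hd hd1
  intro V _ _ G _ hG
  set t := d / (4 * k) with ht
  set p : ℝ := k * ρ ^ d with hp
  have hp0 : 0 ≤ p := by positivity
  have hd1' : (1 : ℝ) ≤ d := by exact_mod_cast hd1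
  have hpd : 4 * p * (d * d : ℕ) ≤ 1 := by
    push_cast
    calc 4 * p * (d * d) = 4 * (k : ℝ) * ((d : ℝ) ^ 2 * ρ ^ d) := by rw [hp]; ring
      _ ≤ 1 := hd
  have hp2 : 2 * p < 1 := by
    have h1 : p ≤ p * (d * d) := le_mul_of_one_le_right hp0 (by nlinarith)
    push_cast at hpd
    nlinarith
  -- By Bernoulli's inequality. Since `(1 + 1 / (4 * k)) * (1 - 1 / (2 * k)) ≤ ρ`, the probability
  -- of a bad vertex is exponentially small in `d`, against at most `d ^ 2` dependencies.
  have h2t : (2 : ℝ) ^ t ≤ (1 + 1 / (4 * k)) ^ d := by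
    have e1 : (2 : ℝ) ≤ (1 + 1 / (4 * k)) ^ (4 * k) := by
      have := one_add_mul_le_pow (a := (1 : ℝ) / (4 * k)) (by linarith) (4 * k)
      have e : ((4 * k : ℕ) : ℝ) * (1 / (4 * k)) = 1 := by push_cast; field_simp
      rw [e] at this; linarith
    calc (2 : ℝ) ^ t ≤ ((1 + 1 / (4 * k)) ^ (4 * k)) ^ t := by gcongr
      _ = (1 + 1 / (4 * k)) ^ (4 * k * t) := by rw [← pow_mul]
      _ ≤ (1 + 1 / (4 * k)) ^ d :=
        pow_le_pow_right₀ (by linarith) (Nat.mul_div_le _ _)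
  obtain ⟨f, hf⟩ := exists_forall_notMem_bad (κ := Fin k) (fun v => G.neighborFinset v)
    (fun v => {f | ∃ c, #{u ∈ G.neighborFinset v | f u = c} ≤ t})
    (by
      intro v f g hfg hf
      simp only [mem_filter, mem_univ, true_and] at hf ⊢
      obtain ⟨c, hc⟩ := hf
      refine ⟨c, ?_⟩
      rwa [filter_congr fun u hu => by rw [← hfg u hu]]) (p := p) hp0
    (by
      intro v
      have h1 : ({f | ∃ c, #{u ∈ G.neighborFinset v | f u = c} ≤ t} : Finset (V → Fin k)) ⊆
          univ.biUnion fun c => {f | #{u ∈ G.neighborFinset v | f u = c} ≤ t} := by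
        intro f hf
        simpa using hf
      have h2 : (#({f | ∃ c, #{u ∈ G.neighborFinset v | f u = c} ≤ t} : Finset (V → Fin k)) : ℝ) ≤
          ∑ c : Fin k, (#{f : V → Fin k | #{u ∈ G.neighborFinset v | f u = c} ≤ t} : ℝ) := by
        exact_mod_cast (card_le_card h1).trans card_biUnion_le
      refine h2.trans ?_
      have h3 : ∀ c : Fin k, (#{f : V → Fin k | #{u ∈ G.neighborFinset v | f u = c} ≤ t} : ℝ) ≤
          ρ ^ d * #(univ : Finset (V → Fin k)) := by
        intro c
        refine (card_rare_le _ c t).trans ?_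
        rw [Fintype.card_fin, G.card_neighborFinset_eq_degree, hG v]
        gcongr
        have e0 : (1 : ℝ) / (2 * k) = 2 * (1 / (4 * k)) := by field_simp; norm_num
        have e1 : (0 : ℝ) ≤ 1 - 1 / (2 * k) := by rw [e0]; linarith
        calc (2 : ℝ) ^ t * (1 - 1 / (2 * k)) ^ d
            ≤ (1 + 1 / (4 * k)) ^ d * (1 - 1 / (2 * k)) ^ d := by gcongr
          _ = ((1 + 1 / (4 * k)) * (1 - 1 / (2 * k))) ^ d := by rw [mul_pow]
          _ ≤ ρ ^ d := by
            have e2 : (0 : ℝ) ≤ (1 + 1 / (4 * k)) * (1 - 1 / (2 * k)) :=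
              mul_nonneg (by linarith) e1
            gcongr
            rw [e0, hρ]; nlinarith
      refine (sum_le_card_nsmul _ _ _ fun c _ => h3 c).trans ?_
      rw [card_univ, Fintype.card_fin, nsmul_eq_mul, hp, mul_assoc])
    (s := d * d)
    (by
      intro v
      have h1 : ({u | ¬ Disjoint (G.neighborFinset u) (G.neighborFinset v)} : Finset V) ⊆
          (G.neighborFinset v).biUnion fun w => G.neighborFinset w := by
        intro u hu
        simp only [mem_filter, mem_univ, true_and, not_disjoint_iff, mem_biUnion,
          SimpleGraph.mem_neighborFinset] at hu ⊢
        obtain ⟨w, h1, h2⟩ := hu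
        exact ⟨w, h2, h1.symm⟩
      refine (card_le_card h1).trans ((card_biUnion_le_card_mul _ _ d fun w _ => ?_).trans ?_)
      · rw [G.card_neighborFinset_eq_degree, hG w]
      · rw [G.card_neighborFinset_eq_degree, hG v]) hpd hp2
  refine ⟨f, fun v c => ?_⟩
  have h1 := hf v
  simp only [mem_filter, mem_univ, true_and, not_exists, not_le] at h1
  have h2 := h1 c
  rw [ht, Nat.div_lt_iff_lt_mul (by positivity)] at h2
  rw [mul_comm]; exact h2.le

/-! ### Rooting a tree. -/

section Rooting

variable {W : Type*} {T : SimpleGraph W}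

/-- The parent is the penultimate vertex of a shortest path from `r`. A second neighbour closer to
`r` has a shortest path avoiding `v`, so acyclicity forces it onto the first path. -/
lemma exists_unique_parent (hT : T.IsTree) (r : W) {v : W} (hv : v ≠ r) :
    ∃ w, T.Adj v w ∧ T.dist r v = T.dist r w + 1 ∧
      ∀ w', T.Adj v w' → T.dist r v = T.dist r w' + 1 → w' = w := by
  classical
  obtain ⟨p, hp, hlen⟩ := hT.connected.exists_path_of_dist r v
  have hnil : ¬ p.Nil := SimpleGraph.Walk.not_nil_of_ne hv.symm
  have hle : ∀ {x y : W} (q : T.Walk x y) (z : W), z ∈ q.support → T.dist x z ≤ q.length :=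
    fun q z hz => (SimpleGraph.dist_le (q.takeUntil z hz)).trans (q.length_takeUntil_le_length hz)
  have hadj : T.Adj v p.penultimate := (p.adj_penultimate hnil).symm
  refine ⟨p.penultimate, hadj, ?_, ?_⟩
  · rcases hT.dist_eq_dist_add_one_of_adj r hadj with h | h
    · exact h
    · have := hle p p.penultimate (p.getVert_mem_support _)
      omega
  · intro w' hw' hd
    obtain ⟨q, hq, hql⟩ := hT.connected.exists_path_of_dist r w'
    have hvq : v ∉ q.support := fun h => by
      have := hle q v h
      omega
    exact hT.isAcyclic.eq_penultimate_of_adj_end hp hw'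
      (hT.isAcyclic.mem_support_of_ne_mem_support_of_adj_of_isPath hp hq hw' hvq)

/-- Every tree can be rooted at any of its vertices. -/
lemma exists_rootedTree (hT : T.IsTree) (r : W) :
    ∃ S : RootedTree W, S.root = r ∧
      ∀ u v, T.Adj u v ↔ (v ≠ r ∧ S.par v = u) ∨ (u ≠ r ∧ S.par u = v) := by
  classical
  choose f hf1 hf2 hf3 using fun (v : W) (hv : v ≠ r) => exists_unique_parent hT r hv
  refine ⟨⟨r, fun v => if h : v = r then r else f v h, fun v => T.dist r v, by simp, by simp, ?_⟩,
    rfl, ?_⟩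
  · intro v hv
    simp only [dif_neg hv]
    exact hf2 v hv
  · intro u v
    constructor
    · intro h
      rcases hT.dist_eq_dist_add_one_of_adj r h with hd | hd
      · right
        have hu : u ≠ r := by rintro rfl; simp at hd
        exact ⟨hu, by simp only [dif_neg hu]; exact (hf3 u hu v h hd).symm⟩
      · left
        have hv : v ≠ r := by rintro rfl; simp at hd
        exact ⟨hv, by simp only [dif_neg hv]; exact (hf3 v hv u h.symm hd).symm⟩
    · rintro (⟨hv, h⟩ | ⟨hu, h⟩)
      · simp only [dif_neg hv] at h
        exact h ▸ (hf1 v hv).symm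
      · simp only [dif_neg hu] at h
        exact h ▸ hf1 u hu

/-- Restrict a rooted tree to a set containing the root and closed under taking parents. -/
def RootedTree.restrict (S : RootedTree W) (p : W → Prop) (hr : p S.root)
    (hp : ∀ w, p w → p (S.par w)) : RootedTree {w // p w} where
  root := ⟨S.root, hr⟩
  par w := ⟨S.par w.1, hp w.1 w.2⟩
  dep w := S.dep w.1
  par_root := Subtype.ext S.par_root
  dep_root := S.dep_root
  dep_par w hw := S.dep_par w.1 fun h => hw (Subtype.ext h)

/-- All degrees equal to one would give `card W = 2 * (card W - 1)`. Rooting at a vertex that is not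
a leaf ensures that every leaf has a parent below or at the root. -/
lemma exists_degree_ne_one [Fintype W] [DecidableRel T.Adj] (hT : T.IsTree)
    (hW : 3 ≤ Fintype.card W) : ∃ r, T.degree r ≠ 1 := by
  classical
  by_contra! hall
  have h1 := T.sum_degrees_eq_twice_card_edges
  have h2 := hT.card_edgeFinset
  simp only [hall, sum_const, card_univ, smul_eq_mul, mul_one] at h1
  omega

end Rooting

/-! ### Completing the embedding by Hall's theorem. -/

/-- A tree with many leaves embeds as a spanning tree, given reservoirs `U` and `R` into which all
small sets expand. -/
theorem isContained_of_expansion {V W : Type*} [Fintype V] [DecidableEq V] [Fintype W]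
    {G : SimpleGraph V} [DecidableRel G.Adj] {T : SimpleGraph W} [DecidableRel T.Adj]
    (hT : T.IsTree) (hVW : Fintype.card W = Fintype.card V) (hV : 3 ≤ Fintype.card V)
    {Δ D m K : ℕ} (hΔ0 : 0 < Δ) (hΔ : T.maxDegree ≤ Δ) (hKΔ : K = 8 * Δ ^ 3)
    (hD : Δ + 1 + K ≤ D) (hJ : Joined G m) (hm : 0 < m) {U R : Finset V} (hUR : Disjoint U R)
    (hexp : ∀ S ∈ ({U, R, (U ∪ R)ᶜ} : Finset (Finset V)), ∀ X : Finset V, #X ≤ 2 * m →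
      (D + 1) * #X ≤ #(nbhd G X ∩ S))
    (hleaf : Δ * (128 * Δ ^ 4 * m + 4 * Δ * #R + #U + #R + 4 * (K + 1) * m + m + 2 * m * D + 2) ≤
      #T.leafFinset) : T.IsContained G := by
  classical
  obtain ⟨r, hr⟩ := exists_degree_ne_one hT (hVW ▸ hV)
  obtain ⟨S, hSr, hSadj⟩ := exists_rootedTree hT r
  have hSΔ : ∀ w, #{v | v ≠ S.root ∧ S.par v = w} ≤ Δ := by
    intro w
    refine le_trans ?_ ((T.degree_le_maxDegree w).trans hΔ)
    rw [← T.card_neighborFinset_eq_degree]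
    apply card_le_card
    intro v hv
    simp only [mem_filter, mem_univ, true_and] at hv
    rw [T.mem_neighborFinset, hSadj]
    exact Or.inl ⟨hSr ▸ hv.1, hv.2⟩
  have hleafdeg : ∀ w, w ∈ T.leafFinset ↔ T.degree w = 1 := by
    intro w; simp [SimpleGraph.leafFinset]
  have hleafr : ∀ w ∈ T.leafFinset, w ≠ r := by
    rintro w hw rfl; exact hr ((hleafdeg w).1 hw)
  have hchild : ∀ w, w ≠ r → S.par w ∉ T.leafFinset := by
    intro w hw hl
    have hl' := hleafr _ hl
    have h1 : T.Adj (S.par w) w := (hSadj _ _).2 (Or.inl ⟨hw, rfl⟩)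
    have h2 : T.Adj (S.par w) (S.par (S.par w)) := (hSadj _ _).2 (Or.inr ⟨hl', rfl⟩)
    have hdeg := (hleafdeg _).1 hl
    rw [← T.card_neighborFinset_eq_degree, card_eq_one] at hdeg
    obtain ⟨x, hx⟩ := hdeg
    have e1 : w = x := by rw [← mem_singleton, ← hx, T.mem_neighborFinset]; exact h1
    have e2 : S.par (S.par w) = x := by rw [← mem_singleton, ← hx, T.mem_neighborFinset]; exact h2
    have d1 := S.dep_par w (hSr ▸ hw)
    have d2 := S.dep_par (S.par w) (hSr ▸ hl')
    rw [e2, ← e1] at d2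
    omega
  -- `L` has one leaf for each parent of leaves, so placing it is a perfect matching problem.
  -- Removing `L` frees at least a `1 / Δ` fraction of the number of leaves, which is the room
  -- needed by `exists_embedding`.
  obtain ⟨L, hL, hLinj, hLimg⟩ := exists_subset_injOn_image_eq_of_surjOn (f := S.par)
    T.leafFinset (T.leafFinset.image S.par) (by intro x hx; simpa using hx)
  have hLl : ∀ w ∈ L, w ∈ T.leafFinset := fun w hw => hL hw
  set P₀ := T.leafFinset.image S.par with hP₀
  have hP₀c : #T.leafFinset ≤ Δ * #P₀ := by
    refine card_le_mul_card_image _ _ fun w _ => ?_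
    refine (card_le_card ?_).trans (hSΔ w)
    intro v hv
    obtain ⟨hv1, hv2⟩ := mem_filter.1 hv
    simp only [mem_filter, mem_univ, true_and]
    exact ⟨hSr ▸ hleafr v hv1, hv2⟩
  have hLc : #L = #P₀ := by rw [← hLimg, card_image_of_injOn hLinj]
  have hparL : ∀ w, w ≠ r → S.par w ∉ L := fun w hw h => hchild w hw (hLl _ h)
  have hrL : r ∉ L := fun h => hleafr r (hLl r h) rfl
  have hclosed : ∀ w, w ∉ L → S.par w ∉ L := by
    intro w hw
    by_cases hwr : w = r
    · rw [hwr, ← hSr, S.par_root, hSr]; exact hrL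
    · exact hparL w hwr
  have hP₀L : ∀ w ∈ P₀, w ∉ L := by
    intro w hw
    obtain ⟨v, hv, rfl⟩ := mem_image.1 hw
    exact hparL v (hleafr v hv)
  set S' := S.restrict (fun w => w ∉ L) (hSr ▸ hrL) hclosed with hS'
  set P : Finset {w // w ∉ L} := P₀.subtype (fun w => w ∉ L) with hP
  have hPc : #P = #P₀ := by
    rw [hP, card_subtype, filter_true_of_mem hP₀L]
  have hWc : Fintype.card {w // w ∉ L} + #P₀ = Fintype.card V := by
    rw [Fintype.card_subtype_compl, Fintype.card_coe, ← hVW, ← hLc]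
    have := card_le_univ L
    omega
  have hbig : 128 * Δ ^ 4 * m + 4 * Δ * #R + #U + #R + 4 * (K + 1) * m + m + 2 * m * D + 2 ≤ #P₀ :=
    le_of_mul_le_mul_left (hleaf.trans hP₀c) hΔ0
  have hS'Δ : ∀ w, #{v | v ≠ S'.root ∧ S'.par v = w} ≤ Δ := by
    intro w
    refine le_trans ?_ (hSΔ w.1)
    rw [← card_map (Function.Embedding.subtype _)]
    apply card_le_card
    intro v hv
    simp only [mem_map, mem_filter, mem_univ, true_and, Function.Embedding.coe_subtype] at hv ⊢
    obtain ⟨v, ⟨hv1, hv2⟩, rfl⟩ := hv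
    exact ⟨fun h => hv1 (Subtype.ext h), congrArg Subtype.val hv2⟩
  obtain ⟨x₀, hx₀⟩ : ∃ x₀, x₀ ∉ U ∪ R := by
    by_contra! hcon
    have h1 : (univ : Finset V) ⊆ U ∪ R := fun x _ => hcon x
    have h2 := (card_le_card h1).trans (card_union_le _ _)
    rw [card_univ] at h2
    omega
  obtain ⟨φ, hφinj, hφadj, hφU, hφR⟩ := S'.exists_embedding G (P := P) (K := K) (m := m) (D := D)
    hΔ0 hS'Δ hKΔ hD hJ hm hUR hx₀
    (fun X hX => by
      have := hexp (U ∪ R)ᶜ (by simp) X hX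
      rwa [sdiff_eq_inter_compl]) (by omega) (by omega)
  set F : Finset V := (univ.image φ)ᶜ with hF
  have hFc : #F = #P₀ := by
    rw [hF, card_compl, card_image_of_injective _ hφinj, card_univ]
    omega
  have hUF : U ⊆ F := by
    intro u hu
    simp only [hF, mem_compl, mem_image, mem_univ, true_and, not_exists]
    rintro w rfl
    exact hφU w hu
  set ψ : L → V := fun l => φ ⟨S.par l.1, hparL l.1 (hleafr _ (hLl _ l.2))⟩ with hψ
  have hψinj : Function.Injective ψ := by
    intro l l' h
    have h1 := congrArg Subtype.val (hφinj h)
    exact Subtype.ext (hLinj l.2 l'.2 h1)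
  have hψP : ∀ w ∈ P, φ w ∈ univ.image ψ := by
    intro w hw
    rw [hP, mem_subtype, ← hLimg] at hw
    obtain ⟨l, hl, hlw⟩ := mem_image.1 hw
    exact mem_image.2 ⟨⟨l, hl⟩, mem_univ _, by simp only [hψ]; congr 1; exact Subtype.ext hlw⟩
  obtain ⟨f, hfinj, hf⟩ := (all_card_le_biUnion_card_iff_exists_injective
    (fun l : L => G.neighborFinset (ψ l) ∩ F)).1 (by
      intro A
      set X := A.image ψ with hX
      have hXc : #X = #A := card_image_of_injective _ hψinj
      have hXn : A.biUnion (fun l : L => G.neighborFinset (ψ l) ∩ F) = nbhd G X ∩ F := by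
        rw [← biUnion_inter, nbhd, hX, image_biUnion]
      rw [hXn, ← hXc]
      by_cases hsmall : #X ≤ 2 * m
      · calc #X ≤ (D + 1) * #X := Nat.le_mul_of_pos_left _ (by omega)
          _ ≤ #(nbhd G X ∩ U) := hexp U (by simp) X hsmall
          _ ≤ _ := card_le_card (inter_subset_inter_left hUF)
      by_contra! hlt
      -- `Y` is not adjacent to `X`, so `#Y < m` and the neighbours of `Y` in `R` are images of
      -- parents outside `X`. Expansion of `Y` into `R` makes them at least `#Y` many, whereas a
      -- violation of Hall's condition means that fewer than `#Y` parents lie outside `X`.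
      set Y := F \ nbhd G X with hY
      have hYc : #Y + #(nbhd G X ∩ F) = #P₀ := by
        rw [hY, inter_comm, card_sdiff_add_card_inter, hFc]
      have hXY : ∀ x ∈ X, ∀ y ∈ Y, ¬ G.Adj x y := fun x hx y hy hxy =>
        (mem_sdiff.1 hy).2 (mem_nbhd.2 ⟨x, hx, hxy⟩)
      have hYm : #Y < m := by
        by_contra! hYm
        obtain ⟨x, hx, y, hy, hxy⟩ := hJ X Y (by omega) hYm
        exact hXY x hx y hy hxy
      have h1 := hexp R (by simp) Y (by omega)
      have h2 : nbhd G Y ∩ R ⊆ univ.image ψ \ X := by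
        intro b hb
        obtain ⟨hb1, hb2⟩ := mem_inter.1 hb
        obtain ⟨w, hw, rfl⟩ := hφR b hb2
        obtain ⟨y, hy, hyb⟩ := mem_nbhd.1 hb1
        exact mem_sdiff.2 ⟨hψP w hw, fun h => hXY _ h y hy hyb.symm⟩
      have h3 := card_le_card h2
      have hXsub : X ⊆ univ.image ψ := image_subset_image (subset_univ _)
      rw [card_sdiff_of_subset hXsub, card_image_of_injective _ hψinj, card_univ,
        Fintype.card_coe, hLc] at h3
      have hAL := card_le_univ A
      rw [Fintype.card_coe, hLc] at hAL
      have h4 : #Y ≤ (D + 1) * #Y := Nat.le_mul_of_pos_left _ (by omega)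
      omega)
  set Φ : W → V := fun w => if h : w ∈ L then f ⟨w, h⟩ else φ ⟨w, h⟩ with hΦ
  have hΦL : ∀ w (h : w ∈ L), Φ w = f ⟨w, h⟩ := fun w h => by simp only [hΦ, dif_pos h]
  have hΦN : ∀ w (h : w ∉ L), Φ w = φ ⟨w, h⟩ := fun w h => by simp only [hΦ, dif_neg h]
  have hfF : ∀ (l : L) (w : {w // w ∉ L}), f l ≠ φ w := by
    intro l w h
    have h1 := (mem_inter.1 (hf l)).2
    rw [h, hF, mem_compl] at h1
    exact h1 (mem_image_of_mem _ (mem_univ _))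
  have hΦinj : Function.Injective Φ := by
    intro w w' h
    by_cases hw : w ∈ L <;> by_cases hw' : w' ∈ L
    · rw [hΦL w hw, hΦL w' hw'] at h
      exact congrArg Subtype.val (hfinj h)
    · rw [hΦL w hw, hΦN w' hw'] at h
      exact absurd h (hfF _ _)
    · rw [hΦN w hw, hΦL w' hw'] at h
      exact absurd h.symm (hfF _ _)
    · rw [hΦN w hw, hΦN w' hw'] at h
      exact congrArg Subtype.val (hφinj h)
  have hΦadj : ∀ w, w ≠ r → G.Adj (Φ (S.par w)) (Φ w) := by
    intro w hwr
    rw [hΦN _ (hparL w hwr)]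
    by_cases hw : w ∈ L
    · rw [hΦL w hw]
      have := (mem_inter.1 (hf ⟨w, hw⟩)).1
      rwa [G.mem_neighborFinset] at this
    · rw [hΦN w hw]
      exact hφadj ⟨w, hw⟩ fun h => hwr ((congrArg Subtype.val h).trans hSr)
  refine ⟨⟨⟨Φ, ?_⟩, hΦinj⟩⟩
  intro u v huv
  rcases (hSadj u v).1 huv with ⟨h, rfl⟩ | ⟨h, rfl⟩
  · exact hΦadj v h
  · exact (hΦadj u h).symm

/-! ### Choice of the reservoirs and constants. -/

/-- Two colour classes of at most average size (up to one colour). -/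
lemma exists_two_small_classes {V : Type*} [Fintype V] {k : ℕ} (hk : 2 ≤ k) (f : V → Fin k) :
    ∃ c₁ c₂, c₁ ≠ c₂ ∧ (k - 1) * #{u | f u = c₁} ≤ Fintype.card V ∧
      (k - 1) * #{u | f u = c₂} ≤ Fintype.card V := by
  classical
  have hsum : ∑ c, #{u | f u = c} = Fintype.card V := by
    rw [← card_univ, ← card_eq_sum_card_fiberwise (fun u _ => mem_univ _)]
  have hsmall : ∀ s : Finset (Fin k), k - 1 ≤ #s →
      ∃ c ∈ s, (k - 1) * #{u | f u = c} ≤ Fintype.card V := by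
    intro s hs
    apply exists_le_of_sum_le (card_pos.1 (by omega))
    rw [← mul_sum, sum_const, smul_eq_mul]
    refine Nat.mul_le_mul hs ?_
    rw [← hsum]
    exact sum_le_sum_of_subset (subset_univ s)
  obtain ⟨c₁, _, h₁⟩ := hsmall univ (by simp)
  obtain ⟨c₂, hc₂, h₂⟩ := hsmall (univ.erase c₁) (by simp)
  exact ⟨c₁, c₂, (ne_of_mem_erase hc₂).symm, h₁, h₂⟩

end TreeEmbedding

open TreeEmbedding in
theorem theorem1p6 (Δ : ℕ) (α : ℝ) (hα : 0 < α) :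
    ∃ C : ℝ, 0 < C ∧ ∀ᶠ d : ℕ in Filter.atTop,
      ∀ (n : ℕ) (lam : ℝ) (V : Type*) [Fintype V] [DecidableEq V]
        (G : SimpleGraph V) [DecidableRel G.Adj],
        G.IsNDLambda n d lam → C ≤ (d : ℝ) / lam →
        ∀ (W : Type*) [Fintype W] (T : SimpleGraph W) [DecidableRel T.Adj],
          T.IsTree → Fintype.card W = n → T.maxDegree ≤ Δ →
          α * (n : ℝ) ≤ (T.leafFinset.card : ℝ) →
          T.IsContained G := by
  obtain ⟨Δ', hΔ', hΔ0⟩ : ∃ Δ', Δ ≤ Δ' ∧ 0 < Δ' := ⟨Δ + 1, by omega, by omega⟩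
  obtain ⟨K, hK⟩ : ∃ K, K = 8 * Δ' ^ 3 := ⟨_, rfl⟩
  obtain ⟨D, hD⟩ : ∃ D, D = Δ' + 1 + K := ⟨_, rfl⟩
  -- With `k` colours, reservoirs of size at most `n / (k - 1)` use up at most half of the leaf
  -- budget `α * n`. The `3` leaves a third colour, into which small sets expand outside `U ∪ R`.
  obtain ⟨k, hk⟩ := exists_nat_ge (2 * Δ' * (4 * Δ' + 2) / α + 3)
  set c : ℕ := 128 * Δ' ^ 4 + 4 * (K + 1) + 1 + 2 * D + 2 with hc
  have hk3 : 3 ≤ k := by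
    have h1 : (0 : ℝ) ≤ 2 * Δ' * (4 * Δ' + 2) / α := by positivity
    have : (3 : ℝ) ≤ k := by linarith
    exact_mod_cast this
  -- As `m ≤ 2 * n / C`, the first term fits all multiples of `m`, collected in `c`, into the other
  -- half of the leaf budget. The second gives the expansion condition `5 * (D + 1) / C < 1 / (4 *
  -- k)`, and the last ensures `lam < d`.
  set C : ℝ := 4 * Δ' * c / α + 20 * k * (D + 1) + 1 with hC
  have hC1 : 1 < C := by
    have h1 : (0 : ℝ) ≤ 4 * Δ' * c / α := by positivity
    have h2 : (0 : ℝ) < 20 * k * (D + 1) := by positivity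
    linarith
  have hC0 : 0 < C := by linarith
  refine ⟨C, hC0, ?_⟩
  filter_upwards [eventually_exists_coloring k (by omega), Filter.eventually_ge_atTop 3,
    Filter.eventually_ge_atTop ⌈C⌉₊] with d hcol hd3 hdC
  intro n lam V _ _ G _ hG hCd W _ T _ hT hWn hTΔ hleaf
  -- Division by zero yields zero, so the ratio bound already excludes `lam ≤ 0`.
  have hlam : 0 < lam := by
    by_contra! h
    have : (d : ℝ) / lam ≤ 0 := div_nonpos_of_nonneg_of_nonpos (by positivity) h
    linarith
  have hd0 : (0 : ℝ) < d := by exact_mod_cast (by omega : 0 < d)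
  have hlamd : lam ≤ d / C := by
    rw [le_div_iff₀ hlam] at hCd
    rw [le_div_iff₀ hC0]; linarith
  have hlamlt : lam < d := lt_of_le_of_lt hlamd (div_lt_self hd0 hC1)
  have hdn : d < n := by
    obtain ⟨w⟩ := hT.connected.nonempty
    have : Nonempty V := Fintype.card_pos_iff.1
      (by rw [hG.card_eq, ← hWn]; exact Fintype.card_pos_iff.2 ⟨w⟩)
    obtain ⟨v⟩ := this
    rw [← hG.regular v, ← hG.card_eq]
    exact G.degree_lt_card_verts v
  have hCn : C ≤ n := by
    have h1 : C ≤ d := Nat.ceil_le.1 hdC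
    have h2 : (d : ℝ) ≤ n := by exact_mod_cast hdn.le
    linarith
  have hn0 : (0 : ℝ) < n := by linarith
  -- Strictly above `n / C ≥ lam * n / d`, as joinedness requires; the bound `m ≤ 2 * n / C` uses `C
  -- ≤ d < n`.
  set m := ⌊(n : ℝ) / C⌋₊ + 1 with hm
  have hm0 : 0 < m := by omega
  have hmlt : (n : ℝ) / C < m := by rw [hm]; push_cast; exact Nat.lt_floor_add_one _
  have hmle : (m : ℝ) ≤ 2 * (n / C) := by
    have h1 : (⌊(n : ℝ) / C⌋₊ : ℝ) ≤ n / C := Nat.floor_le (by positivity)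
    have h2 : 1 ≤ (n : ℝ) / C := by rwa [le_div_iff₀ hC0, one_mul]
    rw [hm]; push_cast; linarith
  obtain ⟨f, hf⟩ := hcol V G hG.regular
  obtain ⟨c₁, c₂, hcc, hc₁, hc₂⟩ := exists_two_small_classes (by omega) f
  set U : Finset V := {u | f u = c₁} with hU
  set R : Finset V := {u | f u = c₂} with hR
  have hUR : Disjoint U R := by
    rw [disjoint_left]
    intro u hu hu'
    exact hcc ((mem_filter.1 hu).2.symm.trans (mem_filter.1 hu').2)
  obtain ⟨c₃, hc₃⟩ : ∃ c₃ : Fin k, c₃ ∉ ({c₁, c₂} : Finset (Fin k)) := by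
    by_contra! h
    have h1 := card_le_card (fun x _ => h x : (univ : Finset (Fin k)) ⊆ {c₁, c₂})
    have h2 := card_le_two (a := c₁) (b := c₂)
    rw [card_univ, Fintype.card_fin] at h1
    omega
  have hclass : ∀ (S : Finset V) (c : Fin k), ({u | f u = c} : Finset V) ⊆ S →
      ∀ v, 1 / (4 * k) * (d : ℝ) ≤ #(G.neighborFinset v ∩ S) := by
    intro S c hS v
    have h1 : #{u ∈ G.neighborFinset v | f u = c} ≤ #(G.neighborFinset v ∩ S) := by
      apply card_le_card
      intro u hu
      obtain ⟨hu1, hu2⟩ := mem_filter.1 hu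
      exact mem_inter.2 ⟨hu1, hS (mem_filter.2 ⟨mem_univ _, hu2⟩)⟩
    have h2 : d ≤ 4 * k * #(G.neighborFinset v ∩ S) := (hf v c).trans (by gcongr)
    have h3 : (d : ℝ) ≤ 4 * k * #(G.neighborFinset v ∩ S) := by exact_mod_cast h2
    have hk0 : (0 : ℝ) < 4 * k := by
      have : (0 : ℝ) < k := by exact_mod_cast (by omega : 0 < k)
      linarith
    rw [one_div, inv_mul_le_iff₀ hk0]
    exact h3
  have hγ : 2 * ((D + 1 : ℕ) : ℝ) * m / n * d + ((D + 1 : ℕ) : ℝ) * lam < 1 / (4 * k) * d := by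
    have hk0 : (0 : ℝ) < k := by exact_mod_cast (by omega : 0 < k)
    push_cast
    have h1 : 2 * ((D : ℝ) + 1) * m / n * d ≤ 2 * ((D : ℝ) + 1) * (2 * (n / C)) / n * d := by
      gcongr
    have h2 : 2 * ((D : ℝ) + 1) * (2 * (n / C)) / n * d = 4 * (D + 1) * (d / C) := by
      field_simp; ring
    have h3 : ((D : ℝ) + 1) * lam ≤ (D + 1) * (d / C) := by gcongr
    have h4 : 5 * ((D : ℝ) + 1) * (d / C) < 1 / (4 * k) * d := by
      have h5 : 20 * k * ((D : ℝ) + 1) < C := by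
        have h1 : (0 : ℝ) ≤ 4 * Δ' * c / α := by positivity
        rw [hC]; linarith
      rw [one_div_mul_eq_div, ← mul_div_assoc, div_lt_div_iff₀ hC0 (by positivity)]
      have := mul_lt_mul_of_pos_right h5 hd0
      linarith
    linarith
  refine isContained_of_expansion hT (hWn.trans hG.card_eq.symm) (by rw [hG.card_eq]; omega) hΔ0
    (hTΔ.trans hΔ') hK hD.ge (joined_of_isNDLambda hG hlam.le hlamlt ?_) hm0 hUR ?_ ?_
  · calc lam * n ≤ d / C * n := by gcongr
      _ = d * (n / C) := by ring
      _ < d * m := by gcongr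
  · intro S hS X hX
    refine expansion_of_isNDLambda hG hlam.le hlamlt (γ := 1 / (4 * k)) ?_ (by omega) hγ hX
    simp only [mem_insert, mem_singleton] at hS
    rcases hS with rfl | rfl | rfl
    · exact hclass _ c₁ Subset.rfl
    · exact hclass _ c₂ Subset.rfl
    · refine hclass _ c₃ fun u hu => ?_
      have hu' := (mem_filter.1 hu).2
      simp only [mem_insert, mem_singleton, not_or] at hc₃
      simp only [hU, hR, mem_compl, mem_union, mem_filter, mem_univ, true_and, not_or, hu']
      exact hc₃
  · have hkk : ((k - 1 : ℕ) : ℝ) = k - 1 := by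
      rw [Nat.cast_sub (by omega)]; simp
    have hk1 : (0 : ℝ) < k - 1 := by
      have : (3 : ℝ) ≤ k := by exact_mod_cast hk3
      linarith
    have hsize : ∀ s : ℕ, (k - 1) * s ≤ Fintype.card V → (s : ℝ) ≤ n / (k - 1) := by
      intro s hs
      rw [le_div_iff₀ hk1, ← hkk, mul_comm, ← hG.card_eq]
      exact_mod_cast hs
    have hUs := hsize _ hc₁
    have hRs := hsize _ hc₂
    have hm1 : (1 : ℝ) ≤ m := by exact_mod_cast hm0
    have hA : (Δ' : ℝ) * ((4 * Δ' + 2) * (n / (k - 1))) ≤ α * n / 2 := by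
      have h1 : 2 * Δ' * (4 * Δ' + 2) / α ≤ k - 1 := by linarith
      rw [div_le_iff₀ hα] at h1
      rw [← mul_div_assoc, ← mul_div_assoc, div_le_div_iff₀ hk1 (by norm_num)]
      have := mul_le_mul_of_nonneg_right h1 hn0.le
      linarith
    have hB : (Δ' : ℝ) * (c * m) ≤ α * n / 2 := by
      have h1 : 4 * Δ' * c / α ≤ C := by
        have h2 : (0 : ℝ) ≤ 20 * k * (D + 1) := by positivity
        rw [hC]; linarith
      rw [div_le_iff₀ hα] at h1
      have h2 : (Δ' : ℝ) * (c * m) ≤ Δ' * (c * (2 * (n / C))) := by gcongr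
      have h3 : (Δ' : ℝ) * (c * (2 * (n / C))) ≤ α * n / 2 := by
        rw [← mul_div_assoc, ← mul_div_assoc, ← mul_div_assoc,
          div_le_div_iff₀ hC0 (by norm_num)]
        have := mul_le_mul_of_nonneg_right h1 hn0.le
        linarith
      linarith
    have hmain : (Δ' : ℝ) * (128 * Δ' ^ 4 * m + 4 * Δ' * #R + #U + #R + 4 * (K + 1) * m + m +
        2 * m * D + 2) ≤ Δ' * (c * m + (4 * Δ' + 2) * (n / (k - 1))) := by
      refine mul_le_mul_of_nonneg_left ?_ (by positivity)
      rw [hc]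
      push_cast
      have h1 : 4 * (Δ' : ℝ) * #R ≤ 4 * Δ' * (n / (k - 1)) := by gcongr
      linarith
    have : (Δ' : ℝ) * (128 * Δ' ^ 4 * m + 4 * Δ' * #R + #U + #R + 4 * (K + 1) * m + m +
        2 * m * D + 2) ≤ #T.leafFinset := by
      rw [mul_add] at hmain
      linarith
    exact_mod_cast this
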